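/- Let $n\ge 1$, $N\ge 0$, and let $\mathbb V^N=(\mathbb C^n)^{\otimes N}$ be the space of states of an $N$-site chain, with basis $|k_1\dots k_N\rangle$, $k_i\in\{1,\dots,n\}$ (the colors). Let $X^1,\dots,X^{n^2-1}$ be traceless Hermitian $n\times n$ matrices with $\operatorname{tr}(X^aX^b)=\delta_{ab}$ (so that the $iX^a$ form a basis of $\mathfrak{su}(n)$), let $X^a_{\mathbf l}$ denote $X^a$ acting on site $l$, and let $$\mathcal H=\sum_{l=1}^{D(N)}\sum_{a=1}^{n^2-1}J_{l\,l+1}\,X^a_{\mathbf l}X^a_{\mathbf{l+1}},\qquad J_{l\,l+1}>0,$$ where $D(N)=\max(N-1,0)$ for the open chain, and $D(N)=N$, with site $N+1$ identified with site $1$, for the periodic chain (ring). The Lie algebra $\mathfrak{sl}(n,\mathbb C)$ acts on $\mathbb V^N$ by $x\mapsto\sum_i x_{\mathbf i}$; a multiplet is a nonzero invariant irreducible subspace. For $m_1+\dots+m_n=N$ let $\mathbb V^N_{m_1\dots m_n}$ be the span of the $|k_1\dots k_N\rangle$ in which each color $c$ occurs $m_c$ times. For a Young tableau (diagram) $\mathbb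 Y$ with $N$ boxes let $\mathbb V^N_{\mathbb Y}$ be the sum of all subspaces obtained from $\mathbb V^N$ by distributing the $N$ sites among the boxes of $\mathbb Y$, symmetrizing over the sites in each row and then antisymmetrizing over the sites in each column. A lowest-energy state (ground state) of $\mathcal H$ on an $\mathcal H$-invariant subspace is a nonzero eigenvector in it with the least eigenvalue of $\mathcal H$ on that subspace; the ground states on the subspaces $\mathbb V^N_{m_1\dots m_n}$ are called relative ground states. Let $N_1\ge\dots\ge N_n\ge 0$ with $N_1+\dots+N_n=N$, and let $\mathbb Y$ be the Young tableau whose row lengths are the nonzero $N_i$. In the case of the ring assume that $\mathbb Y$ has a definite parity: its (nonempty) rows all have even length or all have odd length. Then there is one multiplet $V^\Omega_{\mathbb Y}\subset\mathbb V^N_{\mathbb Y}$ such that: 1. for every permutation $p$ of $\{1,\dots,n\}$, the relative ground state $\Omega_{N_{p_1}\dots N_{p_n}}$ on $\mathbb V^N_{N_{p_1}\dots N_{p_n}}$, which exists and is unique up to a scalar factor, belongs to $V^\Omega_{\mathbb Y}$; 2. $V^\Omega_{\mathbb Y}$ combines all lowest-energy states of the sector $\mathbb V^N_{\mathbb Y}$: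 the lowest-energy states of $\mathcal H$ on $\mathbb V^N_{\mathbb Y}$ are exactly the nonzero vectors of $V^\Omega_{\mathbb Y}$. -/

import Mathlib

open scoped TensorProduct

noncomputable section

namespace SUChain

/-- The one-site space `V_n = ℂⁿ`, with basis the `n` colors. -/
abbrev Site (n : ℕ) : Type := Fin n → ℂ

/-- The space of states of an `N`-site chain, the `N`-fold tensor power of `ℂⁿ`. -/
abbrev State (n N : ℕ) : Type := ⨂[ℂ] _ : Fin N, Site n

/-- The basis state `|k₁ … k_N⟩`. -/
def ket {n N : ℕ} (k : Fin N → Fin n) : State n N :=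
  PiTensorProduct.tprod ℂ (fun s => (Pi.single (k s) 1 : Site n))

/-- The operator acting as the matrix `x` on the site `s` and as the identity on the others. -/
def siteOp {n N : ℕ} (s : Fin N) (x : Matrix (Fin n) (Fin n) ℂ) : Module.End ℂ (State n N) :=
  PiTensorProduct.map
    (Function.update (fun _ : Fin N => (LinearMap.id : Site n →ₗ[ℂ] Site n)) s (Matrix.toLin' x))

/-- The action `x ↦ ∑_s x_s` of matrices, in particular of `sl(n,ℂ)`, on the states of the chain. -/
def rho {n : ℕ} (N : ℕ) (x : Matrix (Fin n) (Fin n) ℂ) : Module.End ℂ (State n N) :=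
  ∑ s : Fin N, siteOp s x

/-- Invariance of a subspace under `sl(n,ℂ)`. -/
def IsSlInvariant {n N : ℕ} (V : Submodule ℂ (State n N)) : Prop :=
  ∀ x ∈ LieAlgebra.SpecialLinear.sl (Fin n) ℂ, ∀ ψ ∈ V, rho N x ψ ∈ V

/-- A multiplet: a nonzero `sl(n,ℂ)`-invariant subspace on which `sl(n,ℂ)` acts irreducibly. -/
structure IsMultiplet {n N : ℕ} (V : Submodule ℂ (State n N)) : Prop where
  ne_bot : V ≠ ⊥
  invariant : IsSlInvariant V
  irreducible : ∀ W : Submodule ℂ (State n N), W ≤ V → IsSlInvariant W → W = ⊥ ∨ W = V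

/-- `X¹, …, X^{n²-1}` are traceless Hermitian matrices with `tr (X^a X^b) = δ_{ab}`; by
orthonormality and their number, the `i X^a` are then a basis of `su(n)`. -/
structure IsSuBasis {n : ℕ} (X : Fin (n ^ 2 - 1) → Matrix (Fin n) (Fin n) ℂ) : Prop where
  isHermitian : ∀ a, (X a).IsHermitian
  trace_eq_zero : ∀ a, (X a).trace = 0
  trace_mul : ∀ a b, (X a * X b).trace = if a = b then 1 else 0

/-- Boundary conditions: open chain, or periodic chain (ring). -/
inductive Boundary
  | openChain
  | ring

/-- The number `D(N)` of bonds. -/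
def bondCount : Boundary → ℕ → ℕ
  | .openChain, N => N - 1
  | .ring, N => N

theorem bondCount_le (b : Boundary) (N : ℕ) : bondCount b N ≤ N := by
  cases b
  · exact Nat.sub_le N 1
  · exact le_rfl

/-- The left end of the bond `l` (sites are numbered from `0`). -/
def leftSite {b : Boundary} {N : ℕ} (l : Fin (bondCount b N)) : Fin N :=
  ⟨l, lt_of_lt_of_le l.isLt (bondCount_le b N)⟩

/-- The right end of the bond `l`, which is `l + 1`, the site after the last being the first. -/
def rightSite {b : Boundary} {N : ℕ} (l : Fin (bondCount b N)) : Fin N :=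
  ⟨(l + 1) % N,
    Nat.mod_lt _ (lt_of_le_of_lt (Nat.zero_le _) (lt_of_lt_of_le l.isLt (bondCount_le b N)))⟩

/-- The Hamiltonian `∑_l J_{l,l+1} ∑_a X^a_l X^a_{l+1}`. -/
def hamiltonian {n N : ℕ} (b : Boundary) (X : Fin (n ^ 2 - 1) → Matrix (Fin n) (Fin n) ℂ)
    (J : Fin (bondCount b N) → ℝ) : Module.End ℂ (State n N) :=
  ∑ l, (J l : ℂ) • ∑ a, siteOp (leftSite l) (X a) * siteOp (rightSite l) (X a)

/-- The weight subspace spanned by the basis states with `m c` sites of each color `c`. -/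
def weightSpace {n : ℕ} (N : ℕ) (m : Fin n → ℕ) : Submodule ℂ (State n N) :=
  Submodule.span ℂ
    {ψ | ∃ k : Fin N → Fin n, (∀ c, (Finset.univ.filter (fun s => k s = c)).card = m c) ∧ ψ = ket k}

/-- `ψ` is a lowest-energy state of `H` on the subspace `W`: a nonzero eigenvector in `W` whose
eigenvalue is the least one among those of eigenvectors in `W`. -/
def IsGroundState {n N : ℕ} (H : Module.End ℂ (State n N)) (W : Submodule ℂ (State n N))
    (ψ : State n N) : Prop :=
  ψ ∈ W ∧ ψ ≠ 0 ∧ ∃ E : ℝ, H ψ = (E : ℂ) • ψ ∧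
    ∀ E' : ℝ, ∀ φ ∈ W, φ ≠ 0 → H φ = (E' : ℂ) • φ → E ≤ E'

/-- The Young tableau (diagram) with row lengths `N₁ ≥ … ≥ N_n ≥ 0`. -/
def young {n : ℕ} (lam : Fin n → ℕ) (hlam : Antitone lam) : YoungDiagram :=
  YoungDiagram.ofRowLens (List.ofFn lam) hlam.sortedGE_ofFn

/-- All (nonempty) rows have even length, or all have odd length. -/
def HasDefiniteParity (Y : YoungDiagram) : Prop :=
  (∀ r ∈ Y.rowLens, Even r) ∨ (∀ r ∈ Y.rowLens, Odd r)

/-- An indexed Young tableau: the `N` sites are distributed among the boxes of `Y`. -/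
abbrev IndexedTableau (N : ℕ) (Y : YoungDiagram) : Type := Fin N ≃ {x : ℕ × ℕ // x ∈ Y.cells}

/-- The permutation of tensor factors. -/
def permOp {n N : ℕ} (σ : Equiv.Perm (Fin N)) : Module.End ℂ (State n N) :=
  (PiTensorProduct.reindex ℂ (fun _ : Fin N => Site n) σ).toLinearMap

open Classical in
/-- Symmetrization over the sites in each row (up to a positive factor). -/
def rowSymmetrizer (n : ℕ) {N : ℕ} {Y : YoungDiagram} (t : IndexedTableau N Y) :
    Module.End ℂ (State n N) :=
  ∑ σ ∈ Finset.univ.filter (fun σ : Equiv.Perm (Fin N) => ∀ s, (t (σ s)).1.1 = (t s).1.1),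
    permOp σ

open Classical in
/-- Antisymmetrization over the sites in each column (up to a positive factor). -/
def colAntisymmetrizer (n : ℕ) {N : ℕ} {Y : YoungDiagram} (t : IndexedTableau N Y) :
    Module.End ℂ (State n N) :=
  ∑ σ ∈ Finset.univ.filter (fun σ : Equiv.Perm (Fin N) => ∀ s, (t (σ s)).1.2 = (t s).1.2),
    ((Equiv.Perm.sign σ : ℤ) : ℂ) • permOp σ

/-- The multiplet sector of `Y`: the sum of the multiplets obtained from all indexed tableaux of
shape `Y` by symmetrizing along the rows and then antisymmetrizing along the columns. -/
def sector (n N : ℕ) (Y : YoungDiagram) : Submodule ℂ (State n N) :=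
  ⨆ t : IndexedTableau N Y, LinearMap.range (colAntisymmetrizer n t * rowSymmetrizer n t)

end SUChain

end

/-!
Let `P_l` be the operator exchanging the two ends of the bond `l`. By the completeness of the
generators (`IsSuBasis.sum_mul`) the Hamiltonian is `∑_l J_l P_l` up to a constant
(`exists_hamiltonian_eq`), so it commutes with the action of `sl(n, ℂ)`, preserves every subspace
invariant under the permutations of the sites, and is Hermitian for the inner product in which the
basis states are orthonormal.

Multiply every basis state by the sign of its configuration, the parity of the number of its
inversions. An exchange of two different colors along a bond reverses this sign; for the bond
closing the ring this needs the parity assumption (`configSign_comp_swap_ends`). In terms of the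
signed basis the off-diagonal elements of the Hamiltonian are therefore nonpositive, and they
connect all configurations with given numbers of colors. By the Perron–Frobenius argument
(`exists_relative_ground_state`) the relative ground state is unique and its amplitudes in the
signed basis are positive.

Fill the sites into the columns of the diagram one column after the other, color the boxes by rows
and antisymmetrize over the columns. This gives a state of the sector whose nonzero amplitudes in
the signed basis are of one sign, and which thus overlaps with the relative ground state
(`stateInner_colAntisymmetrizer_ket_ne_zero`). Since the projection of the relative ground state on
the sector is again a ground state, the relative ground state belongs to the sector
(`mem_sector_of_overlap`).

Conversely, every nonzero invariant subspace of the sector contains a nonzero state of each of the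
weights in question (`exists_mem_weightSpace_of_le_sector`). Hence the ground states of the sector
have the energy of the relative ground states, and every nonzero invariant subspace of their span
contains the relative ground states. Since invariant subspaces have invariant orthogonal
complements, this span is irreducible.

The second half of the argument replaces highest weight theory by one half of Schur–Weyl duality:
an invariant subspace is preserved by all symmetrizations of operators `⊗ x_s`, by induction on the
number of nontrivial factors (`IsSlInvariant.symOp_mem`), and those of the operators `|k⟩⟨y|`
suffice to reach the required weight.
-/

open scoped TensorProduct

noncomputable section

namespace SUChain

open Module ComplexConjugate

/-! ### Hermitian operators in a basis -/

section CoordInner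

variable {K V : Type*} [Fintype K] [AddCommGroup V] [Module ℂ V]

/-- The inner product on `V` for which the basis `B` is orthonormal. -/
def coordInner (B : Basis K ℂ V) (φ ψ : V) : ℂ := ∑ k, conj (B.repr φ k) * B.repr ψ k

variable (B : Basis K ℂ V)

theorem coordInner_self (φ : V) : coordInner B φ φ = ((∑ k, ‖B.repr φ k‖ ^ 2 : ℝ) : ℂ) := by
  simp [coordInner, Complex.conj_mul']

theorem coordInner_self_eq_zero {φ : V} (h : coordInner B φ φ = 0) : φ = 0 := by
  rw [coordInner_self, Complex.ofReal_eq_zero,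
    Finset.sum_eq_zero_iff_of_nonneg (fun _ _ => by positivity)] at h
  exact B.ext_elem fun k => by simpa using h k (Finset.mem_univ k)

/-- `coordInner` in the form from which Mathlib builds an inner product space. -/
abbrev coordCore : InnerProductSpace.Core ℂ V where
  inner := coordInner B
  conj_inner_symm x y := by simp [coordInner, mul_comm]
  re_inner_nonneg x := by
    rw [coordInner_self]
    change 0 ≤ (((∑ k, ‖B.repr x k‖ ^ 2 : ℝ) : ℂ)).re
    rw [Complex.ofReal_re]
    positivity
  add_left x y z := by simp [coordInner, add_mul, Finset.sum_add_distrib]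
  smul_left x y r := by simp [coordInner, Finset.mul_sum, mul_assoc]
  definite x h := coordInner_self_eq_zero B h

theorem coordInner_add_right (x y z : V) :
    coordInner B x (y + z) = coordInner B x y + coordInner B x z := by
  simp [coordInner, mul_add, Finset.sum_add_distrib]

theorem coordInner_smul_right (c : ℂ) (x y : V) :
    coordInner B x (c • y) = c * coordInner B x y := by
  simp [coordInner, Finset.mul_sum, mul_left_comm]

theorem coordInner_sum_right {ι : Type*} (s : Finset ι) (x : V) (f : ι → V) :
    coordInner B x (∑ i ∈ s, f i) = ∑ i ∈ s, coordInner B x (f i) := by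
  simp only [coordInner, map_sum, Finsupp.finsetSum_apply, Finset.mul_sum]
  exact Finset.sum_comm

theorem coordInner_conj (x y : V) : conj (coordInner B x y) = coordInner B y x := by
  simp [coordInner, mul_comm]

theorem exists_orthogonal_decomposition (U : Submodule ℂ V) (ψ : V) :
    ∃ u ∈ U, ∃ u' : V, (∀ v ∈ U, coordInner B v u' = 0) ∧ ψ = u + u' := by
  let := (coordCore B).toNormedAddCommGroup
  let : InnerProductSpace ℂ V := InnerProductSpace.ofCore (coordCore B).toCore
  have : FiniteDimensional ℂ V := Module.Finite.of_basis B
  obtain ⟨u, hu, u', hu', h⟩ := U.exists_add_mem_mem_orthogonal ψ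
  exact ⟨u, hu, u', fun v hv => (Submodule.mem_orthogonal U u').1 hu' v hv, h⟩

/-- The variational principle: on a nonzero invariant subspace a Hermitian operator has a least
eigenvalue, which bounds its expectation values from below and is attained as an expectation value
only by eigenvectors. -/
theorem exists_least_eigenvalue {H : End ℂ V}
    (hH : ∀ φ ψ, coordInner B (H φ) ψ = coordInner B φ (H ψ))
    {W : Submodule ℂ V} (hW : ∀ ψ ∈ W, H ψ ∈ W) (hne : W ≠ ⊥) :
    ∃ E : ℝ, (∃ ψ ∈ W, ψ ≠ 0 ∧ H ψ = (E : ℂ) • ψ) ∧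
      ∀ φ ∈ W, E * (coordInner B φ φ).re ≤ (coordInner B φ (H φ)).re ∧
        ((coordInner B φ (H φ)).re ≤ E * (coordInner B φ φ).re → H φ = (E : ℂ) • φ) := by
  let := (coordCore B).toNormedAddCommGroup
  let : InnerProductSpace ℂ V := InnerProductSpace.ofCore (coordCore B).toCore
  have : FiniteDimensional ℂ V := Module.Finite.of_basis B
  have hHs : H.IsSymmetric := hH
  have hT := hHs.restrict_invariant hW
  set T := H.restrict hW with hTdef
  have : Nontrivial W := Submodule.nontrivial_iff_ne_bot.2 hne
  let b := hT.eigenvectorBasis rfl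
  let e := hT.eigenvalues rfl
  have : Nonempty (Fin (finrank ℂ W)) := ⟨⟨0, finrank_pos⟩⟩
  obtain ⟨i₀, hi₀⟩ := Finite.exists_min e
  have hTb : ∀ (v : W) i, b.repr (T v) i = (e i : ℂ) * b.repr v i := fun v i =>
    hT.eigenvectorBasis_apply_self_apply rfl v i
  have hexp : ∀ v : W, (inner ℂ v (T v)).re = ∑ i, e i * ‖b.repr v i‖ ^ 2 := by
    intro v
    rw [← b.repr.inner_map_map v (T v), PiLp.inner_apply, Complex.re_sum]
    refine Finset.sum_congr rfl fun i _ => ?_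
    rw [hTb, RCLike.inner_apply, mul_assoc, Complex.mul_conj']
    norm_cast
  have hnorm : ∀ v : W, (inner ℂ v v).re = ∑ i, ‖b.repr v i‖ ^ 2 := by
    intro v
    rw [← b.repr.inner_map_map v v, PiLp.inner_apply, Complex.re_sum]
    refine Finset.sum_congr rfl fun i _ => ?_
    rw [RCLike.inner_apply, Complex.mul_conj']
    norm_cast
  refine ⟨e i₀, ⟨b i₀, (b i₀).2, ?_, ?_⟩, fun φ hφ => ?_⟩
  · have := b.orthonormal.ne_zero i₀
    simpa using this
  · have := congrArg Subtype.val (hT.apply_eigenvectorBasis rfl i₀)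
    exact this
  · have h1 := hexp ⟨φ, hφ⟩
    have h2 := hnorm ⟨φ, hφ⟩
    change (coordInner B φ (H φ)).re = _ at h1
    change (coordInner B φ φ).re = _ at h2
    rw [h1, h2, Finset.mul_sum]
    have hle : ∀ i ∈ Finset.univ, e i₀ * ‖b.repr ⟨φ, hφ⟩ i‖ ^ 2 ≤ e i * ‖b.repr ⟨φ, hφ⟩ i‖ ^ 2 :=
      fun i _ => mul_le_mul_of_nonneg_right (hi₀ i) (by positivity)
    refine ⟨Finset.sum_le_sum hle, fun h => ?_⟩
    have heq := (Finset.sum_eq_sum_iff_of_le hle).1 (le_antisymm (Finset.sum_le_sum hle) h)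
    have : T ⟨φ, hφ⟩ = (e i₀ : ℂ) • (⟨φ, hφ⟩ : W) := by
      apply b.repr.injective
      ext i
      rw [hTb, map_smul, PiLp.smul_apply, smul_eq_mul]
      rcases mul_eq_mul_right_iff.1 (heq i (Finset.mem_univ i)) with h | h
      · rw [h]
      · have : b.repr ⟨φ, hφ⟩ i = 0 := by simpa using h
        rw [this, mul_zero, mul_zero]
    exact congrArg Subtype.val this

end CoordInner

variable {n N : ℕ}

/-! ### Amplitudes of states -/

/-- The basis of the states `|k₁ … k_N⟩`. -/
def ketBasis (n N : ℕ) : Basis (Fin N → Fin n) ℂ (State n N) :=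
  Basis.piTensorProduct fun _ => Pi.basisFun ℂ (Fin n)

theorem ketBasis_apply (k : Fin N → Fin n) : ketBasis n N k = ket k := by
  simp [ketBasis, ket]

/-- The amplitudes of a state in the basis of the `|k₁ … k_N⟩`. -/
def coord : State n N ≃ₗ[ℂ] ((Fin N → Fin n) → ℂ) := (ketBasis n N).equivFun

theorem coord_ket (k l : Fin N → Fin n) : coord (ket k) l = if l = k then 1 else 0 := by
  rw [← ketBasis_apply, coord, Basis.equivFun_apply, Basis.repr_self, Finsupp.single_apply]
  simp only [eq_comm]

theorem sum_coord_smul_ket (ψ : State n N) : ∑ k, coord ψ k • ket k = ψ := by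
  simpa only [ketBasis_apply, coord] using (ketBasis n N).sum_equivFun ψ

theorem linearMap_ext_ket {f g : End ℂ (State n N)} (h : ∀ k, f (ket k) = g (ket k)) : f = g :=
  (ketBasis n N).ext fun k => by simpa only [ketBasis_apply] using h k

/-- The inner product of states for which the `|k₁ … k_N⟩` are orthonormal. -/
abbrev stateInner (φ ψ : State n N) : ℂ := coordInner (ketBasis n N) φ ψ

theorem stateInner_eq (φ ψ : State n N) :
    stateInner φ ψ = ∑ k, conj (coord φ k) * coord ψ k := rfl

theorem stateInner_ket_left (k : Fin N → Fin n) (ψ : State n N) :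
    stateInner (ket k) ψ = coord ψ k := by
  simp [stateInner_eq, coord_ket]

/-- Operators are adjoint to each other if their matrix elements between basis states are. -/
theorem stateInner_adjoint {f g : End ℂ (State n N)}
    (h : ∀ k l, coord (f (ket k)) l = conj (coord (g (ket l)) k)) (φ ψ : State n N) :
    stateInner (f φ) ψ = stateInner φ (g ψ) := by
  have hf : ∀ l, coord (f φ) l = ∑ k, coord φ k * coord (f (ket k)) l := fun l => by
    conv_lhs => rw [← sum_coord_smul_ket φ]
    simp
  have hg : ∀ k, coord (g ψ) k = ∑ l, coord ψ l * coord (g (ket l)) k := fun k => by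
    conv_lhs => rw [← sum_coord_smul_ket ψ]
    simp
  simp only [stateInner_eq, hf, hg, map_sum, map_mul, Finset.mul_sum, Finset.sum_mul]
  rw [Finset.sum_comm]
  refine Finset.sum_congr rfl fun k _ => Finset.sum_congr rfl fun l _ => ?_
  rw [h k l, Complex.conj_conj]
  ring

/-! ### Operators on tensor products -/

/-- The operator acting as the matrix `x s` on each site `s`. -/
def tensorOp (x : Fin N → Matrix (Fin n) (Fin n) ℂ) : End ℂ (State n N) :=
  PiTensorProduct.map fun s => Matrix.toLin' (x s)

theorem coord_tensorOp_ket (x : Fin N → Matrix (Fin n) (Fin n) ℂ) (k l : Fin N → Fin n) :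
    coord (tensorOp x (ket k)) l = ∏ s, x s (l s) (k s) := by
  rw [tensorOp, ket, PiTensorProduct.map_tprod, coord, Basis.equivFun_apply, ketBasis,
    Basis.piTensorProduct_repr_tprod_apply]
  simp

theorem tensorOp_mul (x y : Fin N → Matrix (Fin n) (Fin n) ℂ) :
    tensorOp x * tensorOp y = tensorOp (x * y) := by
  rw [tensorOp, tensorOp, tensorOp, ← PiTensorProduct.map_mul]
  congr 1
  ext1 s
  rw [Pi.mul_apply, Matrix.toLin'_mul]
  rfl

theorem tensorOp_one : tensorOp (1 : Fin N → Matrix (Fin n) (Fin n) ℂ) = 1 := by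
  simp only [tensorOp, Pi.one_apply, Matrix.toLin'_one]
  exact PiTensorProduct.map_id

theorem siteOp_eq_tensorOp (s : Fin N) (x : Matrix (Fin n) (Fin n) ℂ) :
    siteOp s x = tensorOp (Function.update 1 s x) := by
  rw [siteOp, tensorOp]
  congr 1
  ext1 r
  rcases eq_or_ne r s with rfl | h
  · simp
  · simp [h]

theorem permOp_ket (σ : Equiv.Perm (Fin N)) (k : Fin N → Fin n) :
    permOp σ (ket k) = ket (k ∘ σ.symm) := by
  rw [permOp, ket, LinearEquiv.coe_coe, PiTensorProduct.reindex_tprod]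
  rfl

theorem coord_permOp (σ : Equiv.Perm (Fin N)) (ψ : State n N) (k : Fin N → Fin n) :
    coord (permOp σ ψ) k = coord ψ (k ∘ σ) := by
  conv_lhs => rw [← sum_coord_smul_ket ψ]
  simp only [map_sum, map_smul, permOp_ket, Finset.sum_apply, Pi.smul_apply, coord_ket,
    ← Equiv.comp_symm_eq, smul_eq_mul, mul_ite, mul_one, mul_zero]
  simp

theorem permOp_one : permOp (1 : Equiv.Perm (Fin N)) = (1 : End ℂ (State n N)) :=
  linearMap_ext_ket fun k => by rw [permOp_ket]; rfl

theorem permOp_mul (σ τ : Equiv.Perm (Fin N)) :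
    permOp (σ * τ) = (permOp σ * permOp τ : End ℂ (State n N)) :=
  linearMap_ext_ket fun k => by
    rw [permOp_ket, Module.End.mul_apply, permOp_ket, permOp_ket]
    rfl

theorem permOp_mul_tensorOp (σ : Equiv.Perm (Fin N)) (x : Fin N → Matrix (Fin n) (Fin n) ℂ) :
    permOp σ * tensorOp x = tensorOp (x ∘ σ.symm) * permOp σ :=
  linearMap_ext_ket fun k => by
    apply coord.injective
    ext l
    rw [Module.End.mul_apply, Module.End.mul_apply, coord_permOp, permOp_ket, coord_tensorOp_ket,
      coord_tensorOp_ket, ← Equiv.prod_comp σ.symm]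
    simp

theorem rho_mul_permOp (x : Matrix (Fin n) (Fin n) ℂ) (σ : Equiv.Perm (Fin N)) :
    rho N x * permOp σ = permOp σ * rho N x := by
  rw [rho, Finset.sum_mul, Finset.mul_sum, ← Equiv.sum_comp σ]
  refine Finset.sum_congr rfl fun s _ => ?_
  rw [siteOp_eq_tensorOp, siteOp_eq_tensorOp, permOp_mul_tensorOp,
    Function.update_comp_equiv]
  simp

theorem stateInner_permOp (σ : Equiv.Perm (Fin N)) (φ ψ : State n N) :
    stateInner (permOp σ φ) ψ = stateInner φ (permOp σ⁻¹ ψ) := by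
  refine stateInner_adjoint (fun k l => ?_) φ ψ
  have h : l ∘ σ = k ↔ k ∘ ⇑σ⁻¹ = l := by
    rw [← Equiv.eq_comp_symm, eq_comm]
    rfl
  simp only [coord_permOp, coord_ket, apply_ite conj, map_one, map_zero, h]

theorem stateInner_tensorOp (x : Fin N → Matrix (Fin n) (Fin n) ℂ) (φ ψ : State n N) :
    stateInner (tensorOp x φ) ψ = stateInner φ (tensorOp (fun s => (x s).conjTranspose) ψ) := by
  refine stateInner_adjoint (fun k l => ?_) φ ψ
  simp [coord_tensorOp_ket]

theorem stateInner_rho (x : Matrix (Fin n) (Fin n) ℂ) (φ ψ : State n N) :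
    stateInner (rho N x φ) ψ = stateInner φ (rho N x.conjTranspose ψ) := by
  rw [stateInner, ← coordInner_conj]
  simp only [rho, LinearMap.sum_apply, coordInner_sum_right, map_sum]
  refine Finset.sum_congr rfl fun s _ => ?_
  rw [coordInner_conj, siteOp_eq_tensorOp, siteOp_eq_tensorOp]
  refine (stateInner_tensorOp _ φ ψ).trans ?_
  congr 3
  ext1 r
  rcases eq_or_ne r s with rfl | h
  · simp
  · simp [h]

/-! ### The Hamiltonian as a sum of transpositions -/

/-- Completeness of the generators, obtained by inverting a square matrix: orthonormality says that
the `X^a` and `1/√n`, as the rows of an `n² × n²` matrix, have a right inverse. -/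
theorem IsSuBasis.sum_mul {X : Fin (n ^ 2 - 1) → Matrix (Fin n) (Fin n) ℂ} (hn : 1 ≤ n)
    (hX : IsSuBasis X) (i j k l : Fin n) :
    ∑ a, X a i j * X a k l =
      (if i = l ∧ j = k then 1 else 0) - if i = j ∧ k = l then (n : ℂ)⁻¹ else 0 := by
  let Z : Option (Fin (n ^ 2 - 1)) → Matrix (Fin n) (Fin n) ℂ
    | none => ((Real.sqrt n : ℝ) : ℂ)⁻¹ • 1
    | some a => X a
  have hn' : (n : ℂ) ≠ 0 := by exact_mod_cast (by omega : n ≠ 0)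
  have hsq : ((Real.sqrt n : ℝ) : ℂ)⁻¹ * ((Real.sqrt n : ℝ) : ℂ)⁻¹ = (n : ℂ)⁻¹ := by
    rw [← mul_inv, ← Complex.ofReal_mul, Real.mul_self_sqrt (Nat.cast_nonneg n),
      Complex.ofReal_natCast]
  have hZ : ∀ a b, (Z a * Z b).trace = if a = b then 1 else 0 := by
    rintro (_ | a) (_ | b)
    · simp [Z, smul_smul, hsq, hn']
    · simp [Z, hX.trace_eq_zero]
    · simp [Z, hX.trace_eq_zero]
    · simp [Z, hX.trace_mul]
  let R : Matrix (Option (Fin (n ^ 2 - 1))) (Fin n × Fin n) ℂ := fun a p => Z a p.1 p.2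
  let C : Matrix (Fin n × Fin n) (Option (Fin (n ^ 2 - 1))) ℂ := fun p a => Z a p.2 p.1
  have hRC : R * C = 1 := by
    ext a b
    rw [Matrix.one_apply, ← hZ, Matrix.trace, Matrix.mul_apply, Fintype.sum_prod_type]
    rfl
  have hcard : Fintype.card (Option (Fin (n ^ 2 - 1))) = Fintype.card (Fin n × Fin n) := by
    have : 1 ≤ n ^ 2 := Nat.one_le_pow _ _ hn
    simp only [Fintype.card_option, Fintype.card_fin, Fintype.card_prod]
    rw [Nat.sub_add_cancel this, sq]
  have hCR := (Matrix.mul_eq_one_comm_of_card_eq _ _ _ hcard).1 hRC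
  have h := congrFun (congrFun hCR (j, i)) (k, l)
  rw [Matrix.mul_apply, Fintype.sum_option, Matrix.one_apply] at h
  have h0 : C (j, i) none * R none (k, l) = if i = j ∧ k = l then (n : ℂ)⁻¹ else 0 := by
    simp only [C, R, Z, Matrix.smul_apply, Matrix.one_apply, smul_eq_mul]
    by_cases h1 : i = j <;> by_cases h2 : k = l <;> simp [h1, h2, hsq]
  rw [h0] at h
  have h1 : ((j, i) = (k, l)) = (i = l ∧ j = k) := by simp [and_comm]
  simp only [h1] at h
  rw [← h]
  simp [C, R, Z]

/-- The interaction of two sites is the operator permuting them, up to a constant. For coinciding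
sites, as on the ring with one site, it is constant. -/
theorem IsSuBasis.exists_sum_siteOp_mul_siteOp {X : Fin (n ^ 2 - 1) → Matrix (Fin n) (Fin n) ℂ}
    (hn : 1 ≤ n) (hX : IsSuBasis X) (r s : Fin N) :
    ∃ c : ℝ, ∑ a, siteOp r (X a) * siteOp s (X a) =
      (permOp (Equiv.swap r s) + (c : ℂ) • 1 : End ℂ (State n N)) := by
  rcases eq_or_ne r s with rfl | hrs
  · refine ⟨n - (n : ℝ)⁻¹ - 1, linearMap_ext_ket fun k => coord.injective (funext fun l => ?_)⟩
    have h1 : ∀ a, coord ((siteOp r (X a) * siteOp r (X a)) (ket k)) l =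
        (∑ j, X a (l r) j * X a j (k r)) *
          ∏ t ∈ Finset.univ.erase r, if l t = k t then 1 else 0 := by
      intro a
      rw [siteOp_eq_tensorOp, tensorOp_mul, coord_tensorOp_ket,
        ← Finset.mul_prod_erase _ _ (Finset.mem_univ r)]
      congr 1
      · simp [Matrix.mul_apply]
      · refine Finset.prod_congr rfl fun t ht => ?_
        simp [Finset.ne_of_mem_erase ht, Matrix.one_apply]
    have h2 : ∑ a, ∑ j, X a (l r) j * X a j (k r) =
        if l r = k r then (n : ℂ) - (n : ℂ)⁻¹ else 0 := by
      rw [Finset.sum_comm]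
      simp only [hX.sum_mul hn, Finset.sum_sub_distrib]
      by_cases h : l r = k r
      · have : ∀ x, (k r = x ∧ x = k r) ↔ x = k r := fun x => by
          rw [eq_comm, and_self]
        simp [h, this]
      · have : ∀ x, ¬ (l r = x ∧ x = k r) := fun x hx => h (hx.1.trans hx.2)
        simp [h, this]
    simp only [LinearMap.sum_apply, map_sum, Finset.sum_apply, h1, ← Finset.sum_mul, h2]
    rw [Finset.prod_ite_zero, Equiv.swap_self, ← Equiv.Perm.one_def, permOp_one]
    simp only [LinearMap.add_apply, LinearMap.smul_apply, Module.End.one_apply, map_add, map_smul,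
      Pi.add_apply, Pi.smul_apply, coord_ket, smul_eq_mul]
    by_cases h : l = k
    · subst h
      simp
    · have : ¬ (l r = k r ∧ ∀ t ∈ Finset.univ.erase r, l t = k t) := by
        rintro ⟨h3, h4⟩
        exact h (funext fun t => if ht : t = r then ht ▸ h3 else h4 t (by simp [ht]))
      rcases not_and_or.1 this with h5 | h5
      · simp [h, h5]
      · rw [if_neg h5]
        simp [h]
  · refine ⟨-(n : ℝ)⁻¹, linearMap_ext_ket fun k => coord.injective (funext fun l => ?_)⟩
    have hs : s ∈ Finset.univ.erase r := by simp [hrs.symm]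
    have h1 : ∀ a, coord ((siteOp r (X a) * siteOp s (X a)) (ket k)) l =
        (X a (l r) (k r) * X a (l s) (k s)) *
          ∏ t ∈ (Finset.univ.erase r).erase s, if l t = k t then 1 else 0 := by
      intro a
      rw [siteOp_eq_tensorOp, siteOp_eq_tensorOp, tensorOp_mul, coord_tensorOp_ket,
        ← Finset.mul_prod_erase _ _ (Finset.mem_univ r), ← Finset.mul_prod_erase _ _ hs, mul_assoc]
      congr 1
      · simp [hrs]
      congr 1
      · simp [hrs.symm]
      · refine Finset.prod_congr rfl fun t ht => ?_
        have h1 := Finset.ne_of_mem_erase ht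
        have h2 := Finset.ne_of_mem_erase (Finset.mem_of_mem_erase ht)
        simp [h1, h2, Matrix.one_apply]
    simp only [LinearMap.sum_apply, map_sum, Finset.sum_apply, h1, ← Finset.sum_mul, hX.sum_mul hn]
    simp only [Finset.prod_ite_zero, Finset.prod_const_one, LinearMap.add_apply,
      LinearMap.smul_apply, Module.End.one_apply, map_add, map_smul,
      Pi.add_apply, Pi.smul_apply, coord_ket, coord_permOp, smul_eq_mul]
    have e1 : l ∘ Equiv.swap r s = k ↔
        (l r = k s ∧ k r = l s) ∧ ∀ t ∈ (Finset.univ.erase r).erase s, l t = k t := by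
      constructor
      · rintro rfl
        refine ⟨by simp, fun t ht => ?_⟩
        have h1 := Finset.ne_of_mem_erase ht
        have h2 := Finset.ne_of_mem_erase (Finset.mem_of_mem_erase ht)
        simp [Equiv.swap_apply_of_ne_of_ne h2 h1]
      · rintro ⟨⟨h1, h2⟩, h3⟩
        ext1 t
        rcases eq_or_ne t r with rfl | htr
        · simp [h2]
        rcases eq_or_ne t s with rfl | hts
        · simp [h1]
        simp [Equiv.swap_apply_of_ne_of_ne htr hts, h3 t (by simp [htr, hts])]
    have e2 : l = k ↔
        (l r = k r ∧ l s = k s) ∧ ∀ t ∈ (Finset.univ.erase r).erase s, l t = k t := by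
      constructor
      · rintro rfl
        simp
      · rintro ⟨⟨h1, h2⟩, h3⟩
        ext1 t
        rcases eq_or_ne t r with rfl | htr
        · exact h1
        rcases eq_or_ne t s with rfl | hts
        · exact h2
        exact h3 t (by simp [htr, hts])
    by_cases hD : ∀ t ∈ (Finset.univ.erase r).erase s, l t = k t
    · have e1' := e1.trans (and_iff_left hD)
      have e2' := e2.trans (and_iff_left hD)
      simp only [e1', e2', if_pos hD]
      push_cast
      split_ifs <;> ring
    · have e1' : ¬ l ∘ Equiv.swap r s = k := fun h => hD (e1.1 h).2
      have e2' : ¬ l = k := fun h => hD (e2.1 h).2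
      rw [if_neg hD, if_neg e1', if_neg e2']
      ring

/-- Up to a constant, the Hamiltonian is a combination of transpositions of neighboring sites. -/
theorem exists_hamiltonian_eq (hn : 1 ≤ n)
    {X : Fin (n ^ 2 - 1) → Matrix (Fin n) (Fin n) ℂ} (hX : IsSuBasis X) (b : Boundary)
    (J : Fin (bondCount b N) → ℝ) :
    ∃ c : ℝ, hamiltonian b X J =
      ∑ l, (J l : ℂ) • permOp (Equiv.swap (leftSite l) (rightSite l)) + (c : ℂ) • 1 := by
  choose c hc using fun l : Fin (bondCount b N) =>
    hX.exists_sum_siteOp_mul_siteOp hn (leftSite l) (rightSite l)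
  refine ⟨∑ l, J l * c l, ?_⟩
  simp only [hamiltonian, hc, smul_add, Finset.sum_add_distrib, smul_smul, Complex.ofReal_sum,
    Complex.ofReal_mul, Finset.sum_smul]

/-! ### The sign of a configuration -/

/-- The sign of a configuration of colors: the parity of the number of its inversions, that is, of
pairs of sites whose colors stand in decreasing order. -/
def configSign (k : Fin N → Fin n) : ℤ := ∏ j, ∏ i ∈ Finset.Iio j, if k j < k i then -1 else 1

theorem configSign_mul_self (k : Fin N → Fin n) : configSign k * configSign k = 1 := by
  simp only [configSign, ← Finset.prod_mul_distrib]
  refine Finset.prod_eq_one fun j _ => Finset.prod_eq_one fun i _ => ?_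
  split_ifs <;> rfl

/-- Permuting the sites changes the sign of the configuration by the sign of the permutation, up to
the parity of the number of inversions of the permutation which involve two equal colors. -/
theorem configSign_comp (k : Fin N → Fin n) (σ : Equiv.Perm (Fin N)) :
    (∏ j, ∏ i ∈ Finset.Iio j, if k (σ i) = k (σ j) ∧ σ j < σ i then (-1 : ℤ) else 1) *
      configSign (k ∘ σ) = Equiv.Perm.sign σ * configSign k := by
  -- the antisymmetric function to which the product formula for the sign is applied compares sites
  -- lexicographically, by color and then by position
  let f : Fin N → Fin N → ℤ := fun i j =>
    if k i < k j then 1 else if k j < k i then -1 else if i < j then 1 else if j < i then -1 else 0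
  have hf : ∀ i j, f i j = -f j i := by
    intro i j
    simp only [f]
    rcases lt_trichotomy (k i) (k j) with h | h | h
    · simp [h, h.not_gt]
    · rcases lt_trichotomy i j with h' | h' | h'
      · simp [h, h', h'.not_gt]
      · simp [h']
      · simp [h, h', h'.not_gt]
    · simp [h, h.not_gt]
  have h := σ.prod_Iio_comp_eq_sign_mul_prod hf
  have h1 : ∏ j, ∏ i ∈ Finset.Iio j, f i j = configSign k := by
    refine Finset.prod_congr rfl fun j _ => Finset.prod_congr rfl fun i hi => ?_
    simp only [f, if_pos (Finset.mem_Iio.1 hi)]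
    rcases lt_trichotomy (k i) (k j) with h | h | h <;> simp [h, h.not_gt]
  rw [h1] at h
  rw [Int.cast_id] at h
  rw [← h, configSign, ← Finset.prod_mul_distrib]
  refine Finset.prod_congr rfl fun j _ => ?_
  rw [← Finset.prod_mul_distrib]
  refine Finset.prod_congr rfl fun i hi => ?_
  have hij : σ i ≠ σ j := fun h => (Finset.mem_Iio.1 hi).ne (σ.injective h)
  simp only [f, Function.comp_apply]
  rcases lt_trichotomy (k (σ i)) (k (σ j)) with h | h | h
  · simp [h, h.ne, h.not_gt]
  · rcases hij.lt_or_gt with h' | h' <;> simp [h, h', h'.not_gt]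
  · simp [h, h.ne', h.not_gt]

theorem configSign_comp_of_inversions {k : Fin N → Fin n} {σ : Equiv.Perm (Fin N)}
    (h : ∀ i j, i < j → σ j < σ i → k (σ i) ≠ k (σ j)) :
    configSign (k ∘ σ) = Equiv.Perm.sign σ * configSign k := by
  rw [← configSign_comp, Finset.prod_eq_one, one_mul]
  refine fun j _ => Finset.prod_eq_one fun i hi => if_neg ?_
  rintro ⟨h1, h2⟩
  exact h i j (Finset.mem_Iio.1 hi) h2 h1

theorem configSign_comp_swap_adjacent {k : Fin N → Fin n} {r s : Fin N} (hrs : (s : ℕ) = r + 1)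
    (hk : k r ≠ k s) : configSign (k ∘ Equiv.swap r s) = -configSign k := by
  have hne : r ≠ s := by
    rintro rfl
    omega
  rw [configSign_comp_of_inversions, Equiv.Perm.sign_swap hne]
  · simp
  · intro i j hij hji
    -- the only inversion of the transposition is the pair of transposed sites
    have : i = r ∧ j = s := by
      rw [Equiv.swap_apply_def, Equiv.swap_apply_def] at hji
      split_ifs at hji <;> simp only [Fin.ext_iff, Fin.lt_def] at * <;> omega
    rw [this.1, this.2, Equiv.swap_apply_left, Equiv.swap_apply_right]
    exact hk.symm

/-- The number of sites with color `c`. -/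
def colorCount (k : Fin N → Fin n) (c : Fin n) : ℕ := (Finset.univ.filter fun s => k s = c).card

theorem colorCount_pos (k : Fin N → Fin n) (s : Fin N) : 0 < colorCount k (k s) :=
  Finset.card_pos.2 ⟨s, by simp⟩

theorem colorCount_comp (k : Fin N → Fin n) (σ : Equiv.Perm (Fin N)) :
    colorCount (k ∘ σ) = colorCount k := by
  ext c
  exact Finset.card_bij (fun s _ => σ s) (by simp) (by simp)
    fun s hs => ⟨σ.symm s, by simpa using hs, by simp⟩

theorem exists_perm_of_colorCount_eq {k k' : Fin N → Fin n} (h : colorCount k = colorCount k') :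
    ∃ σ : Equiv.Perm (Fin N), k' = k ∘ σ := by
  have e : ∀ c, Nonempty ({s // k' s = c} ≃ {s // k s = c}) := fun c => by
    rw [← Fintype.card_eq, Fintype.card_subtype, Fintype.card_subtype]
    exact (congrFun h c).symm
  refine ⟨(Equiv.sigmaFiberEquiv k').symm.trans
    ((Equiv.sigmaCongrRight fun c => (e c).some).trans (Equiv.sigmaFiberEquiv k)), ?_⟩
  ext1 s
  exact ((e (k' s)).some ⟨s, rfl⟩).2.symm

/-- On the ring, the sign also changes when different colors are exchanged between the last site and
the first, provided that the numbers of sites with these colors have the same parity. -/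
theorem configSign_comp_swap_ends {k : Fin N → Fin n} {r s : Fin N} (hr : (r : ℕ) = 0)
    (hs : (s : ℕ) + 1 = N) (hk : k r ≠ k s)
    (hpar : Even (colorCount k (k r) + colorCount k (k s))) :
    configSign (k ∘ Equiv.swap r s) = -configSign k := by
  have hne : r ≠ s := fun h => hk (congrArg k h)
  have h := configSign_comp k (Equiv.swap r s)
  rw [Equiv.Perm.sign_swap hne] at h
  let A := (Finset.univ.filter fun t => k t = k s).erase s
  let B := (Finset.univ.filter fun t => k t = k r).erase r
  have hA : A.card + 1 = colorCount k (k s) := Finset.card_erase_add_one (by simp)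
  have hB : B.card + 1 = colorCount k (k r) := Finset.card_erase_add_one (by simp)
  -- an inversion with equal colors pairs an end with an inner site of the color of the other end
  have hterm : ∀ j, ∀ i ∈ Finset.Iio j,
      (if k (Equiv.swap r s i) = k (Equiv.swap r s j) ∧ Equiv.swap r s j < Equiv.swap r s i
        then (-1 : ℤ) else 1) =
      (if i = r then if j ∈ A then -1 else 1 else 1) *
        (if j = s then if i ∈ B then -1 else 1 else 1) := by
    intro j i hij
    have hij := Finset.mem_Iio.1 hij
    have hjr : j ≠ r := fun h => by
      rw [h, Fin.lt_def] at hij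
      omega
    have his : i ≠ s := fun h => by
      rw [h, Fin.lt_def] at hij
      omega
    have hle : ∀ t : Fin N, t ≠ s → t < s := fun t ht => by
      rw [Fin.lt_def]
      rw [ne_eq, Fin.ext_iff] at ht
      omega
    have hge : ∀ t : Fin N, t ≠ r → r < t := fun t ht => by
      rw [Fin.lt_def]
      rw [ne_eq, Fin.ext_iff] at ht
      omega
    by_cases hi : i = r <;> by_cases hj : j = s
    · simp [hi, hj, A, B, hk.symm]
    · simp [hi, hj, A, Equiv.swap_apply_of_ne_of_ne hjr hj, hle j hj, eq_comm]
    · simp [hi, hj, B, Equiv.swap_apply_of_ne_of_ne hi his, hge i hi]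
    · simp [hi, hj, Equiv.swap_apply_of_ne_of_ne hi his, Equiv.swap_apply_of_ne_of_ne hjr hj,
        hij.not_gt]
  have hcountA : ∏ j, ∏ i ∈ Finset.Iio j, (if i = r then if j ∈ A then (-1 : ℤ) else 1 else 1) =
      (-1) ^ A.card := by
    rw [← Finset.prod_const, ← Finset.prod_subset (Finset.subset_univ A)]
    · refine Finset.prod_congr rfl fun j hj => ?_
      have : r < j := by
        have : j ≠ r := fun h => hk (by simpa [A, h] using (Finset.mem_filter.1
          (Finset.mem_of_mem_erase hj)).2)
        rw [ne_eq, Fin.ext_iff] at this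
        rw [Fin.lt_def]
        omega
      rw [Finset.prod_ite_eq', if_pos (Finset.mem_Iio.2 this), if_pos hj]
    · intro j _ hj
      simp [hj]
  have hcountB : ∏ j, ∏ i ∈ Finset.Iio j, (if j = s then if i ∈ B then (-1 : ℤ) else 1 else 1) =
      (-1) ^ B.card := by
    rw [Finset.prod_eq_single s (fun j _ hj => by simp [hj]) (by simp), ← Finset.prod_const,
      ← Finset.prod_subset (s₁ := B)]
    · exact Finset.prod_congr rfl fun i hi => by simp [hi]
    · intro i hi
      have : i ≠ s := fun h => hk.symm (by simpa [B, h] using (Finset.mem_filter.1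
          (Finset.mem_of_mem_erase hi)).2)
      rw [ne_eq, Fin.ext_iff] at this
      rw [Finset.mem_Iio, Fin.lt_def]
      omega
    · intro i _ hi
      simp [hi]
  have hprod : ∏ j, ∏ i ∈ Finset.Iio j, (if k (Equiv.swap r s i) = k (Equiv.swap r s j) ∧
      Equiv.swap r s j < Equiv.swap r s i then (-1 : ℤ) else 1) = 1 := by
    rw [Finset.prod_congr rfl fun j _ => Finset.prod_congr rfl (hterm j)]
    simp only [Finset.prod_mul_distrib]
    rw [hcountA, hcountB, ← pow_add]
    refine Even.neg_one_pow ?_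
    rw [← hA, ← hB] at hpar
    obtain ⟨q, hq⟩ := hpar
    exact ⟨q - 1, by omega⟩
  rw [hprod, one_mul] at h
  rw [h]
  simp

/-- The sum of any two nonzero occupation numbers is even. -/
def EvenSums (m : Fin n → ℕ) : Prop := ∀ c d, 0 < m c → 0 < m d → Even (m c + m d)

theorem configSign_comp_swap_bond {b : Boundary} {k : Fin N → Fin n}
    (hpar : b = Boundary.ring → EvenSums (colorCount k)) (l : Fin (bondCount b N))
    (hk : k (leftSite l) ≠ k (rightSite l)) :
    configSign (k ∘ Equiv.swap (leftSite l) (rightSite l)) = -configSign k := by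
  by_cases hl : (l : ℕ) + 1 < N
  · exact configSign_comp_swap_adjacent (Nat.mod_eq_of_lt hl) hk
  · cases b with
    | openChain =>
      have := l.isLt
      simp only [bondCount] at this
      omega
    | ring =>
      have h1 : (l : ℕ) + 1 = N := le_antisymm (Nat.succ_le_of_lt l.isLt) (not_lt.1 hl)
      rw [Equiv.swap_comm]
      refine configSign_comp_swap_ends ?_ h1 hk.symm
        (hpar rfl _ _ (colorCount_pos k _) (colorCount_pos k _))
      change ((l : ℕ) + 1) % N = 0
      rw [h1, Nat.mod_self]

/-- The transpositions along the bonds generate all permutations of the sites. -/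
theorem forall_comp_perm_of_bonds {b : Boundary} {p : (Fin N → Fin n) → Prop}
    (hp : ∀ k, p k → ∀ l : Fin (bondCount b N),
      p (k ∘ Equiv.swap (leftSite l) (rightSite l)))
    {k : Fin N → Fin n} (hk : p k) (σ : Equiv.Perm (Fin N)) : p (k ∘ σ) := by
  rcases N with _ | N
  · rwa [Subsingleton.elim (k ∘ σ) k]
  · have hσ : σ ∈ Submonoid.closure
        (Set.range fun i : Fin N => Equiv.swap i.castSucc i.succ) := by
      rw [Equiv.Perm.mclosure_swap_castSucc_succ]
      trivial
    induction hσ using Submonoid.closure_induction_right with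
    | one => exact hk
    | mul_right σ _ τ hτ ih =>
      obtain ⟨i, rfl⟩ := hτ
      have hi : (i : ℕ) < bondCount b (N + 1) := by
        cases b
        · exact i.isLt
        · exact i.isLt.trans (Nat.lt_succ_self N)
      have h1 : leftSite (⟨i, hi⟩ : Fin (bondCount b (N + 1))) = i.castSucc := rfl
      have h2 : rightSite (⟨i, hi⟩ : Fin (bondCount b (N + 1))) = i.succ :=
        Fin.ext (Nat.mod_eq_of_lt (Nat.succ_lt_succ i.isLt))
      have := hp _ ih ⟨i, hi⟩
      rwa [h1, h2] at this

/-! ### Relative ground states -/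

theorem mem_weightSpace {m : Fin n → ℕ} {ψ : State n N} :
    ψ ∈ weightSpace N m ↔ ∀ k, coord ψ k ≠ 0 → colorCount k = m := by
  constructor
  · intro h
    induction h using Submodule.span_induction with
    | mem x hx =>
      obtain ⟨k, hk, rfl⟩ := hx
      intro l hl
      rw [coord_ket] at hl
      have : l = k := by
        by_contra h
        exact hl (if_neg h)
      subst this
      exact funext hk
    | zero => simp
    | add x y _ _ hx hy =>
      intro k hk
      by_cases h : coord x k = 0
      · refine hy k fun h' => hk ?_
        rw [map_add, Pi.add_apply, h, h', add_zero]
      · exact hx k h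
    | smul c x _ hx =>
      intro k hk
      exact hx k fun h => hk (by rw [map_smul, Pi.smul_apply, h, smul_zero])
  · intro h
    rw [← sum_coord_smul_ket ψ]
    refine Submodule.sum_mem _ fun k _ => ?_
    by_cases hk : coord ψ k = 0
    · rw [hk, zero_smul]
      exact Submodule.zero_mem _
    · exact Submodule.smul_mem _ _ (Submodule.subset_span ⟨k, congrFun (h k hk), rfl⟩)

theorem ket_mem_weightSpace {m : Fin n → ℕ} {k : Fin N → Fin n} (hk : colorCount k = m) :
    ket k ∈ weightSpace N m :=
  Submodule.subset_span ⟨k, congrFun hk, rfl⟩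

theorem ket_ne_zero (k : Fin N → Fin n) : ket k ≠ (0 : State n N) := fun h => by
  have := congrArg (fun ψ => coord ψ k) h
  simp [coord_ket] at this

/-- The Hamiltonian `∑_l J_l P_l + c`, where `P_l` transposes the ends of the bond `l`. -/
def exchangeOp (b : Boundary) (J : Fin (bondCount b N) → ℝ) (c : ℝ) : End ℂ (State n N) :=
  ∑ l, (J l : ℂ) • permOp (Equiv.swap (leftSite l) (rightSite l)) + (c : ℂ) • 1

variable {b : Boundary} {J : Fin (bondCount b N) → ℝ} {c : ℝ}

theorem coord_exchangeOp (ψ : State n N) (k : Fin N → Fin n) :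
    coord (exchangeOp b J c ψ) k =
      ∑ l, (J l : ℂ) * coord ψ (k ∘ Equiv.swap (leftSite l) (rightSite l)) + c * coord ψ k := by
  simp only [exchangeOp, LinearMap.add_apply, LinearMap.sum_apply, LinearMap.smul_apply,
    Module.End.one_apply, map_add, map_sum, map_smul, Pi.add_apply, Pi.smul_apply, Finset.sum_apply,
    coord_permOp, smul_eq_mul]

theorem exchangeOp_mem {U : Submodule ℂ (State n N)}
    (hU : ∀ (σ : Equiv.Perm (Fin N)), ∀ ψ ∈ U, permOp σ ψ ∈ U) {ψ : State n N} (hψ : ψ ∈ U) :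
    exchangeOp b J c ψ ∈ U := by
  simp only [exchangeOp, LinearMap.add_apply, LinearMap.sum_apply, LinearMap.smul_apply,
    Module.End.one_apply]
  exact U.add_mem (U.sum_mem fun l _ => U.smul_mem _ (hU _ _ hψ)) (U.smul_mem _ hψ)

theorem permOp_mem_weightSpace {m : Fin n → ℕ} (σ : Equiv.Perm (Fin N)) {ψ : State n N}
    (hψ : ψ ∈ weightSpace N m) : permOp σ ψ ∈ weightSpace N m :=
  mem_weightSpace.2 fun k hk => by
    rw [coord_permOp] at hk
    rw [← mem_weightSpace.1 hψ _ hk, colorCount_comp]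

theorem stateInner_exchangeOp (φ ψ : State n N) :
    stateInner (exchangeOp b J c φ) ψ = stateInner φ (exchangeOp b J c ψ) := by
  rw [stateInner, ← coordInner_conj]
  simp only [exchangeOp, LinearMap.add_apply, LinearMap.sum_apply, LinearMap.smul_apply,
    Module.End.one_apply, coordInner_add_right, coordInner_sum_right, coordInner_smul_right,
    map_add, map_sum, map_mul, Complex.conj_ofReal, coordInner_conj]
  congr 1
  refine Finset.sum_congr rfl fun l _ => ?_
  have h := stateInner_permOp (Equiv.swap (leftSite l) (rightSite l)) φ ψ
  rw [Equiv.swap_inv] at h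
  exact congrArg _ h

theorem stateInner_self_pos {φ : State n N} (hφ : φ ≠ 0) : 0 < (stateInner φ φ).re := by
  have h0 : stateInner φ φ = _ := coordInner_self (ketBasis n N) φ
  rw [h0, Complex.ofReal_re]
  refine lt_of_le_of_ne (by positivity) fun h => hφ (coordInner_self_eq_zero (ketBasis n N) ?_)
  rw [coordInner_self, ← h, Complex.ofReal_zero]

/-- The state with amplitudes of the same modulus as those of `ψ`, whose phases are the signs of the
configurations. -/
def signed (ψ : State n N) : State n N :=
  coord.symm fun k => ((configSign k * ‖coord ψ k‖ : ℝ) : ℂ)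

theorem coord_signed (ψ : State n N) (k : Fin N → Fin n) :
    coord (signed ψ) k = ((configSign k * ‖coord ψ k‖ : ℝ) : ℂ) := by
  rw [signed, LinearEquiv.apply_symm_apply]

theorem configSign_mul_self_real (k : Fin N → Fin n) :
    (configSign k : ℝ) * configSign k = 1 := by
  exact_mod_cast configSign_mul_self k

theorem signed_mem_weightSpace {m : Fin n → ℕ} {ψ : State n N} (hψ : ψ ∈ weightSpace N m) :
    signed ψ ∈ weightSpace N m :=
  mem_weightSpace.2 fun k hk => mem_weightSpace.1 hψ k fun h => hk (by simp [coord_signed, h])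

theorem stateInner_signed (ψ : State n N) :
    stateInner (signed ψ) (signed ψ) = stateInner ψ ψ := by
  simp only [stateInner_eq]
  refine Finset.sum_congr rfl fun k _ => ?_
  rw [coord_signed, Complex.conj_ofReal, Complex.conj_mul', ← Complex.ofReal_mul,
    mul_mul_mul_comm, configSign_mul_self_real, one_mul, ← sq, Complex.ofReal_pow]

theorem configSign_mul_comp_swap {m : Fin n → ℕ} (hm : b = Boundary.ring → EvenSums m)
    {k : Fin N → Fin n} (hk : colorCount k = m) (l : Fin (bondCount b N)) :
    k ∘ Equiv.swap (leftSite l) (rightSite l) = k ∨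
      (configSign k : ℝ) * configSign (k ∘ Equiv.swap (leftSite l) (rightSite l)) = -1 := by
  by_cases h : k (leftSite l) = k (rightSite l)
  · left
    ext1 s
    simp only [Function.comp_apply, Equiv.swap_apply_def]
    split_ifs with h1 h2
    · rw [h1, h]
    · rw [h2, h]
    · rfl
  · right
    rw [configSign_comp_swap_bond (fun hb => hk ▸ hm hb) l h]
    push_cast
    rw [mul_neg, configSign_mul_self_real]

/-- Replacing the phases of the amplitudes by the signs of the configurations does not raise the
energy, since in terms of these signs every exchange has nonpositive off-diagonal elements. -/
theorem energy_signed_le {m : Fin n → ℕ} (hm : b = Boundary.ring → EvenSums m)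
    (hJ : ∀ l, 0 < J l) {ψ : State n N} (hψ : ψ ∈ weightSpace N m) :
    (stateInner (signed ψ) (exchangeOp b J c (signed ψ))).re ≤
      (stateInner ψ (exchangeOp b J c ψ)).re := by
  simp only [stateInner_eq, coord_exchangeOp, Complex.re_sum]
  refine Finset.sum_le_sum fun k _ => ?_
  by_cases h0 : coord ψ k = 0
  · simp [coord_signed, h0]
  have hk := mem_weightSpace.1 hψ k h0
  rw [mul_add, mul_add, Complex.add_re, Complex.add_re, Finset.mul_sum, Finset.mul_sum,
    Complex.re_sum, Complex.re_sum]
  refine add_le_add (Finset.sum_le_sum fun l _ => ?_) (le_of_eq ?_)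
  · rw [mul_left_comm, mul_left_comm (conj (coord ψ k)), Complex.re_ofReal_mul,
      Complex.re_ofReal_mul]
    refine mul_le_mul_of_nonneg_left ?_ (hJ l).le
    rw [coord_signed, coord_signed, Complex.conj_ofReal, ← Complex.ofReal_mul, Complex.ofReal_re,
      mul_mul_mul_comm]
    rcases configSign_mul_comp_swap hm hk l with h | h
    · rw [h, configSign_mul_self_real, Complex.conj_mul', one_mul, ← Complex.ofReal_pow,
        Complex.ofReal_re, sq]
    · rw [h]
      have h1 := (abs_le.1 (Complex.abs_re_le_norm
        (conj (coord ψ k) * coord ψ (k ∘ Equiv.swap (leftSite l) (rightSite l))))).1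
      rw [norm_mul, RCLike.norm_conj] at h1
      linarith
  · rw [mul_left_comm, mul_left_comm (conj (coord ψ k)), Complex.re_ofReal_mul,
      Complex.re_ofReal_mul, coord_signed, Complex.conj_ofReal, Complex.conj_mul',
      ← Complex.ofReal_mul, mul_mul_mul_comm, configSign_mul_self_real, one_mul, ← sq,
      Complex.ofReal_pow]

/-- If an amplitude of an eigenvector of the form `signed ψ` vanishes, so do its neighbors, as the
eigenvalue equation equates to zero a sum of terms of one sign. -/
theorem coord_eq_zero_of_neighbor {m : Fin n → ℕ} (hm : b = Boundary.ring → EvenSums m)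
    (hJ : ∀ l, 0 < J l) {ψ : State n N} {E : ℝ}
    (hE : exchangeOp b J c (signed ψ) = (E : ℂ) • signed ψ) {k : Fin N → Fin n}
    (hk : colorCount k = m) (h0 : coord ψ k = 0) (l : Fin (bondCount b N)) :
    coord ψ (k ∘ Equiv.swap (leftSite l) (rightSite l)) = 0 := by
  have h := congrArg (fun φ => coord φ k) hE
  simp only [coord_exchangeOp, coord_signed, h0, map_smul, Pi.smul_apply, norm_zero, mul_zero,
    Complex.ofReal_zero, smul_zero, add_zero] at h
  have h' : ∑ l, J l * (configSign (k ∘ Equiv.swap (leftSite l) (rightSite l)) *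
      ‖coord ψ (k ∘ Equiv.swap (leftSite l) (rightSite l))‖) = 0 := by
    exact_mod_cast h
  have hterm : ∀ l, (configSign k : ℝ) *
      (J l * (configSign (k ∘ Equiv.swap (leftSite l) (rightSite l)) *
        ‖coord ψ (k ∘ Equiv.swap (leftSite l) (rightSite l))‖)) =
      -(J l * ‖coord ψ (k ∘ Equiv.swap (leftSite l) (rightSite l))‖) := fun l => by
    rcases configSign_mul_comp_swap hm hk l with h | h
    · rw [h, h0]
      simp
    · linear_combination
        (J l * ‖coord ψ (k ∘ Equiv.swap (leftSite l) (rightSite l))‖) * h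
  have hsum := congrArg (fun x => (configSign k : ℝ) * x) h'
  simp only [Finset.mul_sum, hterm, mul_zero, Finset.sum_neg_distrib, neg_eq_zero] at hsum
  rw [Finset.sum_eq_zero_iff_of_nonneg
    (fun l _ => mul_nonneg (hJ l).le (norm_nonneg _))] at hsum
  have := hsum l (Finset.mem_univ l)
  simpa [(hJ l).ne'] using this

/-- The Perron–Frobenius theorem for the Hamiltonian on a weight subspace: the least eigenvalue is
simple, with an eigenvector whose amplitudes have the signs of the configurations. -/
theorem exists_relative_ground_state {m : Fin n → ℕ} (hm : b = Boundary.ring → EvenSums m)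
    (hJ : ∀ l, 0 < J l) (hne : weightSpace N m ≠ ⊥) :
    ∃ E : ℝ, ∃ Ω ∈ weightSpace N m, Ω ≠ 0 ∧ exchangeOp b J c Ω = (E : ℂ) • Ω ∧
      (∀ k, colorCount k = m → ∃ g : ℝ, 0 < g ∧ coord Ω k = ((configSign k * g : ℝ) : ℂ)) ∧
      (∀ E' : ℝ, ∀ φ ∈ weightSpace N m, φ ≠ 0 → exchangeOp b J c φ = (E' : ℂ) • φ → E ≤ E') ∧
      ∀ φ ∈ weightSpace N m, exchangeOp b J c φ = (E : ℂ) • φ → ∃ a : ℂ, φ = a • Ω := by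
  obtain ⟨E, ⟨ψ, hψW, hψ0, hψE⟩, hmin⟩ := exists_least_eigenvalue (ketBasis n N)
    (H := exchangeOp b J c) stateInner_exchangeOp
    (fun φ hφ => exchangeOp_mem (fun σ ξ hξ => permOp_mem_weightSpace σ hξ) hφ) hne
  have hexp : ∀ (φ : State n N) (E' : ℝ), exchangeOp b J c φ = (E' : ℂ) • φ →
      (stateInner φ (exchangeOp b J c φ)).re = E' * (stateInner φ φ).re := fun φ E' h => by
    rw [h, stateInner, coordInner_smul_right, Complex.re_ofReal_mul]
  have hsigned : ∀ φ ∈ weightSpace N m, exchangeOp b J c φ = (E : ℂ) • φ →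
      exchangeOp b J c (signed φ) = (E : ℂ) • signed φ := fun φ hφ h => by
    refine (hmin _ (signed_mem_weightSpace hφ)).2 ?_
    have h1 := energy_signed_le (c := c) hm hJ hφ
    rw [hexp φ E h, ← stateInner_signed] at h1
    exact h1
  have hnode : ∀ φ ∈ weightSpace N m, exchangeOp b J c φ = (E : ℂ) • φ →
      ∀ k, colorCount k = m → coord φ k = 0 → φ = 0 := fun φ hφ h k hk h0 => by
    apply coord.injective
    ext k'
    rw [map_zero, Pi.zero_apply]
    by_contra hk'
    obtain ⟨σ, rfl⟩ := exists_perm_of_colorCount_eq (hk.trans (mem_weightSpace.1 hφ k' hk').symm)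
    refine hk' (forall_comp_perm_of_bonds (b := b)
      (p := fun k => colorCount k = m ∧ coord φ k = 0) (fun q hq l => ⟨?_, ?_⟩) ⟨hk, h0⟩ σ).2
    · rw [colorCount_comp, hq.1]
    · exact coord_eq_zero_of_neighbor hm hJ (hsigned φ hφ h) hq.1 hq.2 l
  have hΩ : signed ψ ≠ 0 := fun h => by
    have h1 := stateInner_self_pos hψ0
    rw [← stateInner_signed, h] at h1
    simp [stateInner_eq] at h1
  refine ⟨E, signed ψ, signed_mem_weightSpace hψW, hΩ, hsigned ψ hψW hψE, fun k hk => ?_,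
    fun E' φ hφ hφ0 h => ?_, fun φ hφ h => ?_⟩
  · exact ⟨‖coord ψ k‖, norm_pos_iff.2 fun h0 => hψ0 (hnode ψ hψW hψE k hk h0), coord_signed ψ k⟩
  · have h1 := (hmin φ hφ).1
    have h2 := hexp φ E' h
    rw [stateInner] at h2
    rw [h2] at h1
    exact le_of_mul_le_mul_right h1 (stateInner_self_pos hφ0)
  · -- a combination of the two eigenvectors which vanishes at some configuration is zero
    obtain ⟨k, hk0⟩ : ∃ k, coord (signed ψ) k ≠ 0 := by
      by_contra! hall
      exact hΩ (coord.injective (by rw [map_zero]; exact funext hall))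
    have hk := mem_weightSpace.1 (signed_mem_weightSpace hψW) k hk0
    refine ⟨coord φ k / coord (signed ψ) k, sub_eq_zero.1 (hnode _ (Submodule.sub_mem _ hφ
      (Submodule.smul_mem _ _ (signed_mem_weightSpace hψW))) ?_ k hk ?_)⟩
    · rw [map_sub, map_smul, h, hsigned ψ hψW hψE, smul_sub, smul_comm]
    · simp [hk0]

/-! ### Symmetrized operators preserve invariant subspaces -/

/-- The sum over all distributions of the matrices `x s` among the sites. -/
def symOp (x : Fin N → Matrix (Fin n) (Fin n) ℂ) : End ℂ (State n N) :=
  ∑ σ : Equiv.Perm (Fin N), tensorOp (x ∘ σ)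

theorem symOp_comp (x : Fin N → Matrix (Fin n) (Fin n) ℂ) (τ : Equiv.Perm (Fin N)) :
    symOp (x ∘ τ) = symOp x := by
  rw [symOp, symOp, ← Equiv.sum_comp (Equiv.mulLeft τ) fun σ => tensorOp (x ∘ σ)]
  rfl

/-- A product with `rho N y` is a sum of symmetrized operators again, in which `y` multiplies one of
the factors. -/
theorem symOp_mul_rho (x : Fin N → Matrix (Fin n) (Fin n) ℂ) (y : Matrix (Fin n) (Fin n) ℂ) :
    symOp x * rho N y = ∑ i, symOp (Function.update x i (x i * y)) := by
  simp only [symOp, rho]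
  rw [Finset.sum_comm, Finset.sum_mul]
  refine Finset.sum_congr rfl fun σ _ => ?_
  rw [Finset.mul_sum,
    ← Equiv.sum_comp σ fun i => tensorOp (Function.update x i (x i * y) ∘ σ)]
  refine Finset.sum_congr rfl fun s _ => ?_
  rw [siteOp_eq_tensorOp, tensorOp_mul, Function.update_comp_equiv, Equiv.symm_apply_apply]
  congr 1
  ext1 r
  rcases eq_or_ne r s with rfl | h
  · simp
  · simp [h]

theorem symOp_update_eq {x : Fin N → Matrix (Fin n) (Fin n) ℂ} {i j : Fin N} (h : x i = x j)
    (y : Matrix (Fin n) (Fin n) ℂ) :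
    symOp (Function.update x i y) = symOp (Function.update x j y) := by
  rw [← symOp_comp _ (Equiv.swap i j), Function.update_comp_equiv, Equiv.symm_swap,
    Equiv.swap_apply_left]
  congr 2
  ext1 s
  rw [Function.comp_apply, Equiv.swap_apply_def]
  split_ifs with h1 h2
  · rw [h1, h]
  · rw [h2, h]
  · rfl

theorem rho_one : rho N (1 : Matrix (Fin n) (Fin n) ℂ) = (N : ℂ) • 1 := by
  have h : ∀ s : Fin N, siteOp s (1 : Matrix (Fin n) (Fin n) ℂ) = 1 := fun s => by
    rw [siteOp_eq_tensorOp, ← tensorOp_one]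
    congr 1
    exact Function.update_eq_self s 1
  simp only [rho, h, Finset.sum_const, Finset.card_univ, Fintype.card_fin]
  rw [Nat.cast_smul_eq_nsmul]

theorem siteOp_add_smul_one (s : Fin N) (x : Matrix (Fin n) (Fin n) ℂ) (a : ℂ) :
    siteOp s (x + a • 1) = siteOp s x + a • (siteOp s 1 : End ℂ (State n N)) := by
  refine linearMap_ext_ket fun k => coord.injective (funext fun l => ?_)
  simp only [siteOp_eq_tensorOp, LinearMap.add_apply, LinearMap.smul_apply, map_add, map_smul,
    Pi.add_apply, Pi.smul_apply, coord_tensorOp_ket, smul_eq_mul,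
    ← Finset.mul_prod_erase _ _ (Finset.mem_univ s), Function.update_self, Matrix.add_apply,
    Matrix.smul_apply]
  have h : ∀ z : Matrix (Fin n) (Fin n) ℂ,
      ∏ t ∈ Finset.univ.erase s, (Function.update 1 s z : Fin N → Matrix (Fin n) (Fin n) ℂ) t
        (l t) (k t) = ∏ t ∈ Finset.univ.erase s, (1 : Matrix (Fin n) (Fin n) ℂ) (l t) (k t) :=
    fun z => Finset.prod_congr rfl fun t ht => by
      rw [Function.update_of_ne (Finset.ne_of_mem_erase ht), Pi.one_apply]
  rw [h, h, h]
  ring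

/-- Invariance under traceless matrices implies invariance under all of them. -/
theorem IsSlInvariant.rho_mem (hn : 1 ≤ n) {U : Submodule ℂ (State n N)} (hU : IsSlInvariant U)
    (x : Matrix (Fin n) (Fin n) ℂ) {ψ : State n N} (hψ : ψ ∈ U) : rho N x ψ ∈ U := by
  have hn' : (n : ℂ) ≠ 0 := by exact_mod_cast (by omega : n ≠ 0)
  let a : ℂ := x.trace / n
  have h1 : x - a • 1 ∈ LieAlgebra.SpecialLinear.sl (Fin n) ℂ := by
    change Matrix.traceLinearMap (Fin n) ℂ ℂ (x - a • 1) = 0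
    simp [a, hn']
  have h2 : rho N x = rho N (x - a • 1) + a • rho N 1 := by
    conv_lhs => rw [← sub_add_cancel x (a • 1)]
    simp only [rho, siteOp_add_smul_one, Finset.sum_add_distrib, Finset.smul_sum]
  rw [h2, rho_one]
  exact U.add_mem (hU _ h1 ψ hψ) (U.smul_mem _ (U.smul_mem _ hψ))

/-- The symmetrized operators lie in the algebra generated by the action of the matrices: this is
shown by induction on the number of sites on which they act nontrivially. -/
theorem IsSlInvariant.symOp_mem (hn : 1 ≤ n) {U : Submodule ℂ (State n N)} (hU : IsSlInvariant U)
    (x : Fin N → Matrix (Fin n) (Fin n) ℂ) {ψ : State n N} (hψ : ψ ∈ U) : symOp x ψ ∈ U := by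
  classical
  generalize hd : (Finset.univ.filter fun s => x s ≠ 1).card = d
  induction d using Nat.strong_induction_on generalizing x ψ with
  | _ d ih =>
    by_cases h : ∃ i, x i ≠ 1
    · obtain ⟨i, hi⟩ := h
      let x' := Function.update x i 1
      let S := Finset.univ.filter fun s => x' s ≠ 1
      have hS : S.card < d := by
        rw [← hd]
        refine Finset.card_lt_card ⟨fun s hs => ?_, fun hsub => ?_⟩
        · have hs' : x' s ≠ 1 := (Finset.mem_filter.1 hs).2
          have : s ≠ i := fun h => hs' (by simp [x', h])
          simpa [x', this] using hs'
        · have := (Finset.mem_filter.1 (hsub (Finset.mem_filter.2 ⟨Finset.mem_univ i, hi⟩))).2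
          simp [x'] at this
      -- in the product with `rho`, the matrix `x i` multiplies either another nontrivial matrix or
      -- an identity, and all terms of the second kind are equal
      have hprod : symOp x' * rho N (x i) =
          ∑ s ∈ S, symOp (Function.update x' s (x' s * x i)) +
            ((Finset.univ.filter fun s => ¬ x' s ≠ 1).card : ℂ) • symOp x := by
        rw [symOp_mul_rho, ← Finset.sum_filter_add_sum_filter_not _ (fun s => x' s ≠ 1),
          Nat.cast_smul_eq_nsmul]
        congr 1
        rw [← Finset.sum_const]
        refine Finset.sum_congr rfl fun s hs => ?_
        have hs' : x' s = 1 := not_not.1 (Finset.mem_filter.1 hs).2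
        rw [hs', one_mul, symOp_update_eq (j := i) (by simp [hs', x'])]
        simp [x']
      have h1 : ∑ s ∈ S, symOp (Function.update x' s (x' s * x i)) ψ ∈ U := by
        refine U.sum_mem fun s hs => ih _ (lt_of_le_of_lt (Finset.card_le_card ?_) hS) _ hψ rfl
        intro r hr
        by_cases hrs : r = s
        · rwa [hrs]
        · simpa [S, hrs] using hr
      have h2 : symOp x' (rho N (x i) ψ) ∈ U := ih _ hS _ (hU.rho_mem hn _ hψ) rfl
      have h3 := congrArg (fun f => f ψ) hprod
      simp only [Module.End.mul_apply, LinearMap.add_apply, LinearMap.sum_apply,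
        LinearMap.smul_apply] at h3
      have h4 : ((Finset.univ.filter fun s => ¬ x' s ≠ 1).card : ℂ) • symOp x ψ ∈ U := by
        rw [← sub_eq_iff_eq_add'.2 h3]
        exact U.sub_mem h2 h1
      refine (U.smul_mem_iff ?_).1 h4
      have : i ∈ Finset.univ.filter fun s => ¬ x' s ≠ 1 := by simp [x']
      exact_mod_cast (Finset.card_pos.2 ⟨i, this⟩).ne'
    · push Not at h
      have : x = 1 := funext h
      subst this
      simp only [symOp, LinearMap.sum_apply]
      refine U.sum_mem fun σ _ => ?_
      have : (1 : Fin N → Matrix (Fin n) (Fin n) ℂ) ∘ σ = 1 := rfl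
      rwa [this, tensorOp_one]

/-- The amplitudes of the image under the symmetrization of `|k⟩⟨y|`. -/
theorem coord_symOp_single (k y : Fin N → Fin n) (ψ : State n N) (l : Fin N → Fin n) :
    coord (symOp (fun s => Matrix.single (k s) (y s) (1 : ℂ)) ψ) l =
      ∑ σ : Equiv.Perm (Fin N), if k ∘ σ = l then coord ψ (y ∘ σ) else 0 := by
  simp only [symOp, LinearMap.sum_apply, map_sum, Finset.sum_apply]
  refine Finset.sum_congr rfl fun σ _ => ?_
  conv_lhs => rw [← sum_coord_smul_ket ψ]
  simp only [map_sum, map_smul, Finset.sum_apply, Pi.smul_apply, coord_tensorOp_ket, smul_eq_mul,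
    Function.comp_apply, Matrix.single_apply, Finset.prod_ite_zero, Finset.prod_const_one]
  rw [Finset.sum_eq_single (y ∘ σ)]
  · by_cases h : k ∘ σ = l
    · have : ∀ i, k (σ i) = l i := fun i => congrFun h i
      simp [h, this]
    · have : ¬ ∀ i, k (σ i) = l i := fun h' => h (funext h')
      simp [h, this]
  · intro z _ hz
    rw [if_neg, mul_zero]
    exact fun h => hz (funext fun i => ((h i (Finset.mem_univ i)).2).symm)
  · simp

/-! ### Young symmetrizers -/

variable {Y : YoungDiagram}

theorem stateInner_rowSymmetrizer (t : IndexedTableau N Y) (φ ψ : State n N) :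
    stateInner (rowSymmetrizer n t φ) ψ = stateInner φ (rowSymmetrizer n t ψ) := by
  rw [stateInner, ← coordInner_conj]
  simp only [rowSymmetrizer, LinearMap.sum_apply, coordInner_sum_right, map_sum, coordInner_conj]
  refine Finset.sum_nbij' (fun σ => σ⁻¹) (fun σ => σ⁻¹) ?_ ?_ (by simp) (by simp)
    fun σ _ => stateInner_permOp σ φ ψ
  all_goals
    intro σ hσ
    simp only [Finset.mem_filter, Finset.mem_univ, true_and] at hσ ⊢
    intro s
    rw [← hσ (σ⁻¹ s)]
    simp

theorem stateInner_colAntisymmetrizer (t : IndexedTableau N Y) (φ ψ : State n N) :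
    stateInner (colAntisymmetrizer n t φ) ψ = stateInner φ (colAntisymmetrizer n t ψ) := by
  rw [stateInner, ← coordInner_conj]
  simp only [colAntisymmetrizer, LinearMap.sum_apply, LinearMap.smul_apply, coordInner_sum_right,
    coordInner_smul_right, map_sum, map_mul, coordInner_conj, map_intCast]
  refine Finset.sum_nbij' (fun σ => σ⁻¹) (fun σ => σ⁻¹) ?_ ?_ (by simp) (by simp)
    fun σ _ => ?_
  · intro σ hσ
    simp only [Finset.mem_filter, Finset.mem_univ, true_and] at hσ ⊢
    intro s
    rw [← hσ (σ⁻¹ s)]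
    simp
  · intro σ hσ
    simp only [Finset.mem_filter, Finset.mem_univ, true_and] at hσ ⊢
    intro s
    rw [← hσ (σ⁻¹ s)]
    simp
  · rw [Equiv.Perm.sign_inv]
    exact congrArg _ (stateInner_permOp σ φ ψ)

theorem exists_rowSymmetrizer_colAntisymmetrizer_ne_zero {ψ : State n N}
    (hψ : ψ ∈ sector n N Y) (h0 : ψ ≠ 0) :
    ∃ t : IndexedTableau N Y, rowSymmetrizer n t (colAntisymmetrizer n t ψ) ≠ 0 := by
  by_contra! h
  have horth : ∀ φ ∈ sector n N Y, stateInner φ ψ = 0 := fun φ hφ => by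
    rw [stateInner, ← coordInner_conj, map_eq_zero]
    induction hφ using Submodule.iSup_induction' with
    | mem t φ hφ =>
      obtain ⟨ξ, rfl⟩ := hφ
      rw [← map_eq_zero (starRingEnd ℂ), coordInner_conj, Module.End.mul_apply]
      refine (stateInner_colAntisymmetrizer t _ ψ).trans
        ((stateInner_rowSymmetrizer t ξ _).trans ?_)
      rw [h t]
      simp [stateInner_eq]
    | zero => simp [coordInner]
    | add x y _ _ hx hy => rw [coordInner_add_right, hx, hy, add_zero]
  exact h0 (coordInner_self_eq_zero _ (horth ψ hψ))

/-- A nonzero invariant subspace of the sector of `Y` contains a nonzero state in which the colors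
are distributed as in the rows of `Y`. Such a state is the image of an element of the subspace under
the symmetrization of an operator `|k⟩⟨y|`, where `k` colors the rows of a tableau. -/
theorem exists_mem_weightSpace_of_le_sector (hn : 1 ≤ n) {q : ℕ → Fin n} {m : Fin n → ℕ}
    (hq : ∀ x ∈ Y.cells, ∀ y ∈ Y.cells, q x.1 = q y.1 → x.1 = y.1)
    (hm : ∀ t : IndexedTableau N Y, colorCount (fun s => q (t s).1.1) = m)
    {U : Submodule ℂ (State n N)} (hU : IsSlInvariant U) (hUY : U ≤ sector n N Y) (hne : U ≠ ⊥) :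
    ∃ ψ ∈ U, ψ ≠ 0 ∧ ψ ∈ weightSpace N m := by
  obtain ⟨ψ, hψ, h0⟩ := Submodule.exists_mem_ne_zero_of_ne_bot hne
  obtain ⟨t, ht⟩ := exists_rowSymmetrizer_colAntisymmetrizer_ne_zero (hUY hψ) h0
  obtain ⟨τ, hτ⟩ : ∃ τ : Equiv.Perm (Fin N), rowSymmetrizer n t (permOp τ ψ) ≠ 0 := by
    by_contra! h
    refine ht ?_
    simp only [colAntisymmetrizer, LinearMap.sum_apply, LinearMap.smul_apply, map_sum, map_smul, h,
      smul_zero, Finset.sum_const_zero]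
  obtain ⟨y, hy⟩ : ∃ y, coord (rowSymmetrizer n t (permOp τ ψ)) y ≠ 0 := by
    by_contra! h
    exact hτ (coord.injective (by rw [map_zero]; exact funext h))
  let k : Fin N → Fin n := fun s => q (t s).1.1
  have hcoord : coord (symOp (fun s => Matrix.single (k s) (y s) (1 : ℂ)) ψ) (k ∘ τ) =
      coord (rowSymmetrizer n t (permOp τ ψ)) y := by
    rw [coord_symOp_single, ← Equiv.sum_comp (Equiv.mulRight τ), rowSymmetrizer, Finset.sum_filter]
    simp only [LinearMap.sum_apply, map_sum, Finset.sum_apply]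
    refine Finset.sum_congr rfl fun σ _ => ?_
    have hiff : k ∘ (Equiv.mulRight τ σ) = k ∘ τ ↔ ∀ s, (t (σ s)).1.1 = (t s).1.1 := by
      constructor
      · intro h s
        have h' : k (σ (τ (τ.symm s))) = k (τ (τ.symm s)) := congrFun h (τ.symm s)
        rw [Equiv.apply_symm_apply] at h'
        exact hq _ (t (σ s)).2 _ (t s).2 h'
      · intro h
        ext1 s
        exact congrArg q (h (τ s))
    by_cases h : ∀ s, (t (σ s)).1.1 = (t s).1.1
    · rw [if_pos (hiff.2 h), if_pos h, coord_permOp, coord_permOp]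
      rfl
    · rw [if_neg (mt hiff.1 h), if_neg h]
      simp
  refine ⟨_, hU.symOp_mem hn (fun s => Matrix.single (k s) (y s) (1 : ℂ)) hψ, fun h => hy ?_,
    mem_weightSpace.2 fun l hl => ?_⟩
  · rw [← hcoord, h]
    simp
  · rw [coord_symOp_single] at hl
    obtain ⟨σ, -, hσ⟩ := Finset.exists_ne_zero_of_sum_ne_zero hl
    have : k ∘ σ = l := by
      by_contra h
      exact hσ (if_neg h)
    rw [← this, colorCount_comp, hm t]

/-! ### The sector of a diagram -/

theorem permOp_mul_rowSymmetrizer (τ : Equiv.Perm (Fin N)) (t : IndexedTableau N Y) :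
    permOp τ * rowSymmetrizer n t = rowSymmetrizer n (τ.symm.trans t) * permOp τ := by
  rw [rowSymmetrizer, rowSymmetrizer, Finset.mul_sum, Finset.sum_mul]
  refine Finset.sum_nbij' (fun σ => τ * σ * τ⁻¹) (fun σ => τ⁻¹ * σ * τ) ?_ ?_
    (fun σ _ => by group) (fun σ _ => by group) fun σ _ => ?_
  · intro σ hσ
    simp only [Finset.mem_filter, Finset.mem_univ, true_and] at hσ ⊢
    intro s
    have := hσ (τ.symm s)
    simpa using this
  · intro σ hσ
    simp only [Finset.mem_filter, Finset.mem_univ, true_and] at hσ ⊢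
    intro s
    have := hσ (τ s)
    simpa using this
  · rw [← permOp_mul, ← permOp_mul, inv_mul_cancel_right]

theorem permOp_mul_colAntisymmetrizer (τ : Equiv.Perm (Fin N)) (t : IndexedTableau N Y) :
    permOp τ * colAntisymmetrizer n t = colAntisymmetrizer n (τ.symm.trans t) * permOp τ := by
  rw [colAntisymmetrizer, colAntisymmetrizer, Finset.mul_sum, Finset.sum_mul]
  refine Finset.sum_nbij' (fun σ => τ * σ * τ⁻¹) (fun σ => τ⁻¹ * σ * τ) ?_ ?_
    (fun σ _ => by group) (fun σ _ => by group) fun σ _ => ?_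
  · intro σ hσ
    simp only [Finset.mem_filter, Finset.mem_univ, true_and] at hσ ⊢
    intro s
    have := hσ (τ.symm s)
    simpa using this
  · intro σ hσ
    simp only [Finset.mem_filter, Finset.mem_univ, true_and] at hσ ⊢
    intro s
    have := hσ (τ s)
    simpa using this
  · have hsign : Equiv.Perm.sign (τ * σ * τ⁻¹) = Equiv.Perm.sign σ := by
      rw [Equiv.Perm.sign_mul, Equiv.Perm.sign_mul, Equiv.Perm.sign_inv, mul_comm, ← mul_assoc,
        Int.units_mul_self, one_mul]
    rw [mul_smul_comm, smul_mul_assoc, ← permOp_mul, ← permOp_mul, inv_mul_cancel_right, hsign]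

theorem permOp_mem_sector (τ : Equiv.Perm (Fin N)) {ψ : State n N} (hψ : ψ ∈ sector n N Y) :
    permOp τ ψ ∈ sector n N Y := by
  suffices h : sector n N Y ≤ (sector n N Y).comap (permOp τ) from h hψ
  refine iSup_le fun t => ?_
  rintro _ ⟨ξ, rfl⟩
  rw [Submodule.mem_comap, ← Module.End.mul_apply, ← mul_assoc, permOp_mul_colAntisymmetrizer,
    mul_assoc, permOp_mul_rowSymmetrizer, ← mul_assoc, Module.End.mul_apply]
  exact Submodule.mem_iSup_of_mem (τ.symm.trans t) ⟨_, rfl⟩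

theorem rho_mem_sector (x : Matrix (Fin n) (Fin n) ℂ) {ψ : State n N} (hψ : ψ ∈ sector n N Y) :
    rho N x ψ ∈ sector n N Y := by
  suffices h : sector n N Y ≤ (sector n N Y).comap (rho N x) from h hψ
  refine iSup_le fun t => ?_
  rintro _ ⟨ξ, rfl⟩
  have h1 : rho N x * rowSymmetrizer n t = rowSymmetrizer n t * rho N x := by
    simp only [rowSymmetrizer, Finset.mul_sum, Finset.sum_mul, rho_mul_permOp]
  have h2 : rho N x * colAntisymmetrizer n t = colAntisymmetrizer n t * rho N x := by
    simp only [colAntisymmetrizer, Finset.mul_sum, Finset.sum_mul, mul_smul_comm, smul_mul_assoc,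
      rho_mul_permOp]
  rw [Submodule.mem_comap, ← Module.End.mul_apply, ← mul_assoc, h2, mul_assoc, h1, ← mul_assoc,
    Module.End.mul_apply]
  exact Submodule.mem_iSup_of_mem t ⟨_, rfl⟩

theorem colAntisymmetrizer_ket_mem_sector (q : ℕ → Fin n) (t : IndexedTableau N Y) :
    colAntisymmetrizer n t (ket fun s => q (t s).1.1) ∈ sector n N Y := by
  classical
  let R := Finset.univ.filter fun σ : Equiv.Perm (Fin N) => ∀ s, (t (σ s)).1.1 = (t s).1.1
  have h : rowSymmetrizer n t (ket fun s => q (t s).1.1) =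
      (R.card : ℂ) • ket fun s => q (t s).1.1 := by
    rw [Nat.cast_smul_eq_nsmul, ← Finset.sum_const, rowSymmetrizer, LinearMap.sum_apply]
    refine Finset.sum_congr (Finset.filter_congr_decidable _ _ _) fun σ hσ => ?_
    rw [permOp_ket]
    congr 1
    ext1 s
    have := (Finset.mem_filter.1 hσ).2 (σ.symm s)
    rw [Equiv.apply_symm_apply] at this
    rw [Function.comp_apply, ← this]
  have hR : (R.card : ℂ) ≠ 0 := by
    exact_mod_cast (Finset.card_pos.2 ⟨1, by simp [R]⟩).ne'
  refine ((sector n N Y).smul_mem_iff hR).1 (Submodule.mem_iSup_of_mem t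
    ⟨ket fun s => q (t s).1.1, ?_⟩)
  rw [Module.End.mul_apply, h, map_smul]

/-- If the sites fill the columns one after the other, then antisymmetrizing over the columns a
configuration which is constant on rows and injective on columns yields configurations whose signs
are those of the permutations, so that all terms have overlaps of the same phase with `Ω`. -/
theorem stateInner_colAntisymmetrizer_ket_ne_zero {q : ℕ → Fin n}
    (hq : ∀ x ∈ Y.cells, ∀ y ∈ Y.cells, q x.1 = q y.1 → x.1 = y.1)
    {t : IndexedTableau N Y} (ht : Monotone fun s => (t s).1.2) {Ω : State n N}
    (hΩ : ∀ k, colorCount k = colorCount (fun s => q (t s).1.1) →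
      ∃ g : ℝ, 0 < g ∧ coord Ω k = ((configSign k * g : ℝ) : ℂ)) :
    stateInner (colAntisymmetrizer n t (ket fun s => q (t s).1.1)) Ω ≠ 0 := by
  set k : Fin N → Fin n := fun s => q (t s).1.1 with hk
  rw [stateInner_colAntisymmetrizer, stateInner_ket_left, colAntisymmetrizer]
  choose g hg0 hg using fun σ : Equiv.Perm (Fin N) => hΩ (k ∘ σ) (colorCount_comp k σ)
  simp only [LinearMap.sum_apply, LinearMap.smul_apply, map_sum, map_smul, Finset.sum_apply,
    Pi.smul_apply, coord_permOp, hg]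
  have hterm : ∀ σ : Equiv.Perm (Fin N), (∀ s, (t (σ s)).1.2 = (t s).1.2) →
      ((Equiv.Perm.sign σ : ℤ) : ℂ) • ((configSign (k ∘ σ) * g σ : ℝ) : ℂ) =
        ((configSign k * g σ : ℝ) : ℂ) := fun σ hσ => by
    have h1 : configSign (k ∘ σ) = Equiv.Perm.sign σ * configSign k := by
      refine configSign_comp_of_inversions fun i j hij hji heq => hij.ne ?_
      have hcol : (t (σ i)).1.2 = (t (σ j)).1.2 := by
        refine le_antisymm ?_ (ht hji.le)
        rw [hσ, hσ]
        exact ht hij.le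
      have hrow := hq _ (t (σ i)).2 _ (t (σ j)).2 heq
      exact σ.injective (t.injective (Subtype.ext (Prod.ext hrow hcol)))
    have h2 : ((Equiv.Perm.sign σ : ℤ) : ℂ) * ((Equiv.Perm.sign σ : ℤ) : ℂ) = 1 := by
      rw [← Int.cast_mul, ← Units.val_mul, Int.units_mul_self]
      simp
    rw [h1, smul_eq_mul]
    push_cast
    linear_combination (configSign k * g σ : ℂ) * h2
  rw [Finset.sum_congr rfl fun σ hσ => hterm σ (Finset.mem_filter.1 hσ).2, ← Complex.ofReal_sum,
    Complex.ofReal_ne_zero, ← Finset.mul_sum]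
  refine mul_ne_zero (fun h => ?_) (Finset.sum_pos (fun σ _ => hg0 σ) ⟨1, by simp⟩).ne'
  have := configSign_mul_self_real k
  rw [h, zero_mul] at this
  exact zero_ne_one this

/-- A relative ground state which overlaps with the sector belongs to it: its projection on the
part of the sector of the same weight is again a ground state, hence proportional to it. -/
theorem mem_sector_of_overlap {b : Boundary} {J : Fin (bondCount b N) → ℝ} {c E : ℝ}
    {m : Fin n → ℕ} {Ω : State n N} (hΩW : Ω ∈ weightSpace N m)
    (hE : exchangeOp b J c Ω = (E : ℂ) • Ω)
    (huniq : ∀ φ ∈ weightSpace N m, exchangeOp b J c φ = (E : ℂ) • φ → ∃ a : ℂ, φ = a • Ω)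
    {Ψ : State n N} (hΨ : Ψ ∈ sector n N Y) (hΨW : Ψ ∈ weightSpace N m)
    (hover : stateInner Ψ Ω ≠ 0) : Ω ∈ sector n N Y := by
  let P := sector n N Y ⊓ weightSpace N m
  have hP : ∀ ψ ∈ P, exchangeOp b J c ψ ∈ P := fun ψ hψ =>
    ⟨exchangeOp_mem (fun σ ξ h => permOp_mem_sector σ h) hψ.1,
      exchangeOp_mem (fun σ ξ h => permOp_mem_weightSpace σ h) hψ.2⟩
  obtain ⟨u, hu, u', hu', rfl⟩ := exists_orthogonal_decomposition (ketBasis n N) P Ω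
  -- the defects of `u` and `u'` in the eigenvalue equation are opposite and orthogonal
  have hu0 : exchangeOp b J c u - (E : ℂ) • u = 0 := by
    refine coordInner_self_eq_zero (ketBasis n N) ?_
    set v := exchangeOp b J c u - (E : ℂ) • u with hv
    have hvP : v ∈ P := P.sub_mem (hP u hu) (P.smul_mem _ hu)
    have hv' : v + exchangeOp b J c u' = (E : ℂ) • u' := by
      rw [map_add, smul_add] at hE
      apply add_left_cancel (a := (E : ℂ) • u)
      rw [← add_assoc, hv, add_sub_cancel, hE]
    have h1 : coordInner (ketBasis n N) v (exchangeOp b J c u') = 0 :=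
      (stateInner_exchangeOp v u').symm.trans (hu' _ (hP v hvP))
    have h2 := congrArg (coordInner (ketBasis n N) v) hv'
    rwa [coordInner_add_right, coordInner_smul_right, h1, hu' v hvP, add_zero, mul_zero] at h2
  obtain ⟨a, ha⟩ := huniq u hu.2 (sub_eq_zero.1 hu0)
  have ha0 : a ≠ 0 := by
    rintro rfl
    rw [zero_smul] at ha
    apply hover
    rw [ha, zero_add]
    exact hu' Ψ ⟨hΨ, hΨW⟩
  refine ((sector n N Y).smul_mem_iff ha0).1 ?_
  rw [← ha]
  exact hu.1

/-- An invariant subspace of an invariant subspace has an invariant orthogonal complement in it. -/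
theorem IsSlInvariant.exists_orthogonal_complement {U V : Submodule ℂ (State n N)}
    (hU : IsSlInvariant U) (hV : IsSlInvariant V) (hUV : U ≤ V) :
    ∃ U' ≤ V, IsSlInvariant U' ∧ (∀ u ∈ U, ∀ v ∈ U', stateInner u v = 0) ∧ (U' = ⊥ → U = V) := by
  let U' : Submodule ℂ (State n N) :=
    { carrier := {v | v ∈ V ∧ ∀ u ∈ U, coordInner (ketBasis n N) u v = 0}
      add_mem' := fun {v w} hv hw => ⟨V.add_mem hv.1 hw.1, fun u hu => by
        rw [coordInner_add_right, hv.2 u hu, hw.2 u hu, add_zero]⟩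
      zero_mem' := ⟨V.zero_mem, fun u _ => by simp [coordInner]⟩
      smul_mem' := fun a v hv => ⟨V.smul_mem a hv.1, fun u hu => by
        rw [coordInner_smul_right, hv.2 u hu, mul_zero]⟩ }
  refine ⟨U', fun v hv => hv.1, fun x hx v hv => ⟨hV x hx v hv.1, fun u hu => ?_⟩,
    fun u hu v hv => hv.2 u hu, fun hbot => le_antisymm hUV fun v hv => ?_⟩
  · have hx' : x.conjTranspose ∈ LieAlgebra.SpecialLinear.sl (Fin n) ℂ := by
      change Matrix.traceLinearMap (Fin n) ℂ ℂ x.conjTranspose = 0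
      have hx0 : x.trace = 0 := hx
      simp [Matrix.trace_conjTranspose, hx0]
    have h1 := stateInner_rho x.conjTranspose u v
    rw [Matrix.conjTranspose_conjTranspose] at h1
    exact h1.symm.trans (hv.2 _ (hU _ hx' u hu))
  · obtain ⟨u, hu, u', hu', rfl⟩ := exists_orthogonal_decomposition (ketBasis n N) U v
    have hu'V : u' ∈ V := (V.add_mem_iff_right (hUV hu)).1 hv
    have : u' = 0 := (Submodule.eq_bot_iff U').1 hbot u' ⟨hu'V, hu'⟩
    rwa [this, add_zero]

/-! ### The diagram with given row lengths -/

section Young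

variable {lam : Fin n → ℕ} {hlam : Antitone lam}

theorem mem_young {x : ℕ × ℕ} :
    x ∈ (young lam hlam).cells ↔ ∃ h : x.1 < n, x.2 < lam ⟨x.1, h⟩ := by
  rw [YoungDiagram.mem_cells, young, YoungDiagram.mem_ofRowLens]
  simp

theorem card_young : (young lam hlam).cells.card = ∑ i, lam i := by
  have : ∑ i, lam i = (Finset.univ.sigma fun i => Finset.range (lam i)).card := by
    simp
  rw [this]
  symm
  refine Finset.card_bij (fun x _ => ((x.1 : ℕ), x.2)) ?_ ?_ ?_
  · rintro ⟨i, j⟩ h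
    exact mem_young.2 ⟨i.isLt, by simpa using h⟩
  · rintro ⟨i, j⟩ _ ⟨i', j'⟩ _ h
    simp only [Prod.mk.injEq] at h
    obtain ⟨h1, rfl⟩ := h
    obtain rfl := Fin.ext h1
    rfl
  · rintro ⟨i, j⟩ h
    obtain ⟨h1, h2⟩ := mem_young.1 h
    exact ⟨⟨⟨i, h1⟩, j⟩, by simpa using h2, rfl⟩

/-- A tableau whose columns are filled one after the other. -/
theorem exists_tableau_monotone (hsum : ∑ i, lam i = N) :
    ∃ t : IndexedTableau N (young lam hlam), Monotone fun s => (t s).1.2 := by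
  have hcard : Fintype.card (Fin N) = Fintype.card {x // x ∈ (young lam hlam).cells} := by
    rw [Fintype.card_coe, card_young, hsum, Fintype.card_fin]
  obtain ⟨t⟩ := Fintype.card_eq.1 hcard
  exact ⟨(Tuple.sort fun s => (t s).1.2).trans t, Tuple.monotone_sort fun s => (t s).1.2⟩

/-- The color `i` with `p i = r` for the row `r`; the value beyond the last color is irrelevant. -/
def rowColor (hn : 1 ≤ n) (p : Equiv.Perm (Fin n)) (r : ℕ) : Fin n :=
  p.symm (if h : r < n then ⟨r, h⟩ else ⟨0, hn⟩)

theorem rowColor_of_lt (hn : 1 ≤ n) (p : Equiv.Perm (Fin n)) {r : ℕ} (h : r < n) :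
    rowColor hn p r = p.symm ⟨r, h⟩ := by
  rw [rowColor, dif_pos h]

theorem rowColor_injOn (hn : 1 ≤ n) (p : Equiv.Perm (Fin n)) :
    ∀ x ∈ (young lam hlam).cells, ∀ y ∈ (young lam hlam).cells,
      rowColor hn p x.1 = rowColor hn p y.1 → x.1 = y.1 := by
  intro x hx y hy h
  obtain ⟨h1, -⟩ := mem_young.1 hx
  obtain ⟨h2, -⟩ := mem_young.1 hy
  rw [rowColor_of_lt hn p h1, rowColor_of_lt hn p h2] at h
  exact Fin.mk.inj (p.symm.injective h)

theorem colorCount_rowColor (hn : 1 ≤ n) (p : Equiv.Perm (Fin n))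
    (t : IndexedTableau N (young lam hlam)) :
    colorCount (fun s => rowColor hn p (t s).1.1) = fun i => lam (p i) := by
  ext c
  rw [← Finset.card_range (lam (p c)), colorCount]
  have hrow : ∀ s, rowColor hn p (t s).1.1 = c ↔ (t s).1.1 = p c := fun s => by
    obtain ⟨h1, -⟩ := mem_young.1 (t s).2
    rw [rowColor_of_lt hn p h1, Equiv.symm_apply_eq, Fin.ext_iff]
  simp only [hrow]
  refine Finset.card_bij (fun s _ => (t s).1.2) ?_ ?_ ?_
  · intro s hs
    have hs := (Finset.mem_filter.1 hs).2
    obtain ⟨h1, h2⟩ := mem_young.1 (t s).2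
    rw [Finset.mem_range]
    convert h2 using 2
    exact Fin.ext hs.symm
  · intro s hs s' hs' h
    have hs := (Finset.mem_filter.1 hs).2
    have hs' := (Finset.mem_filter.1 hs').2
    exact t.injective (Subtype.ext (Prod.ext (hs.trans hs'.symm) h))
  · intro j hj
    have hmem : ((p c : ℕ), j) ∈ (young lam hlam).cells :=
      mem_young.2 ⟨(p c).isLt, Finset.mem_range.1 hj⟩
    exact ⟨t.symm ⟨_, hmem⟩, by simp, by simp⟩

theorem evenSums_of_hasDefiniteParity (h : HasDefiniteParity (young lam hlam))
    (p : Equiv.Perm (Fin n)) : EvenSums fun i => lam (p i) := by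
  have hmem : ∀ i, 0 < lam i → lam i ∈ (young lam hlam).rowLens := fun i hi => by
    have h1 : (young lam hlam).rowLen i = lam i := by
      have h2 := YoungDiagram.rowLen_ofRowLens (hw := hlam.sortedGE_ofFn) (Fin.cast (by simp) i)
      simpa [young] using h2
    have h2 : (i : ℕ) < (young lam hlam).colLen 0 := by
      rw [← YoungDiagram.mem_iff_lt_colLen, YoungDiagram.mem_iff_lt_rowLen, h1]
      exact hi
    rw [YoungDiagram.rowLens, List.mem_map]
    exact ⟨i, List.mem_range.2 h2, h1⟩
  intro c d hc hd
  rcases h with h | h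
  · exact (h _ (hmem _ hc)).add (h _ (hmem _ hd))
  · exact (h _ (hmem _ hc)).add_odd (h _ (hmem _ hd))

end Young

/-! ### The multiplet of ground states -/

/-- The ground states of the sector form a multiplet, which contains the relative ground states. -/
theorem exists_ground_multiplet (hn : 1 ≤ n) {b : Boundary} {J : Fin (bondCount b N) → ℝ}
    (hJ : ∀ l, 0 < J l) (c : ℝ) {lam : Fin n → ℕ} (hlam : Antitone lam) (hsum : ∑ i, lam i = N)
    (hpar : b = Boundary.ring → HasDefiniteParity (young lam hlam)) :
    ∃ V : Submodule ℂ (State n N), IsMultiplet V ∧ V ≤ sector n N (young lam hlam) ∧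
      (∀ p : Equiv.Perm (Fin n), ∃ Ω : State n N,
        IsGroundState (exchangeOp b J c) (weightSpace N fun i => lam (p i)) Ω ∧
        (∀ Ω' : State n N,
          IsGroundState (exchangeOp b J c) (weightSpace N fun i => lam (p i)) Ω' →
            ∃ a : ℂ, Ω' = a • Ω) ∧
        Ω ∈ V) ∧
      ∀ ψ : State n N, IsGroundState (exchangeOp b J c) (sector n N (young lam hlam)) ψ ↔
        ψ ∈ V ∧ ψ ≠ 0 := by
  set S := sector n N (young lam hlam)
  obtain ⟨t, ht⟩ := exists_tableau_monotone (hlam := hlam) hsum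
  have hW : ∀ p : Equiv.Perm (Fin n), weightSpace N (fun i => lam (p i)) ≠ ⊥ := fun p h =>
    ket_ne_zero _ ((Submodule.eq_bot_iff _).1 h _
      (ket_mem_weightSpace (colorCount_rowColor hn p t)))
  choose E' Ω hΩW hΩ0 hΩE hΩsign hΩmin hΩuniq using fun p : Equiv.Perm (Fin n) =>
    exists_relative_ground_state (b := b) (J := J) (c := c)
      (fun hb => evenSums_of_hasDefiniteParity (hpar hb) p) hJ (hW p)
  have hΩS : ∀ p, Ω p ∈ S := fun p => by
    refine mem_sector_of_overlap (hΩW p) (hΩE p) (hΩuniq p)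
      (colAntisymmetrizer_ket_mem_sector (rowColor hn p) t) ?_
      (stateInner_colAntisymmetrizer_ket_ne_zero (rowColor_injOn hn p) ht fun k hk => ?_)
    · simp only [colAntisymmetrizer, LinearMap.sum_apply, LinearMap.smul_apply]
      exact Submodule.sum_mem _ fun σ _ => Submodule.smul_mem _ _ (permOp_mem_weightSpace σ
        (ket_mem_weightSpace (colorCount_rowColor hn p t)))
    · exact hΩsign p k (hk.trans (colorCount_rowColor hn p t))
  have hmeet : ∀ (p : Equiv.Perm (Fin n)) (U : Submodule ℂ (State n N)), IsSlInvariant U → U ≤ S →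
      U ≠ ⊥ → ∃ ψ ∈ U, ψ ≠ 0 ∧ ψ ∈ weightSpace N (fun i => lam (p i)) := fun p U hU hUS hne =>
    exists_mem_weightSpace_of_le_sector hn (rowColor_injOn hn p) (colorCount_rowColor hn p)
      hU hUS hne
  obtain ⟨E, ⟨ψ₀, hψ₀S, hψ₀0, hψ₀E⟩, hmin⟩ := exists_least_eigenvalue (ketBasis n N)
    (H := exchangeOp b J c) stateInner_exchangeOp
    (fun φ hφ => exchangeOp_mem (fun σ ξ h => permOp_mem_sector σ h) hφ)
    ((Submodule.ne_bot_iff S).2 ⟨Ω 1, hΩS 1, hΩ0 1⟩)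
  have hSmin : ∀ E'' : ℝ, ∀ φ ∈ S, φ ≠ 0 → exchangeOp b J c φ = (E'' : ℂ) • φ → E ≤ E'' :=
    fun E'' φ hφ hφ0 h => by
      have h1 := (hmin φ hφ).1
      rw [h, coordInner_smul_right, Complex.re_ofReal_mul] at h1
      exact le_of_mul_le_mul_right h1 (stateInner_self_pos hφ0)
  let V : Submodule ℂ (State n N) := S ⊓ End.eigenspace (exchangeOp b J c) (E : ℂ)
  have hV : ∀ φ, φ ∈ V ↔ φ ∈ S ∧ exchangeOp b J c φ = (E : ℂ) • φ := fun φ => by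
    rw [Submodule.mem_inf, End.mem_eigenspace_iff]
  have hVinv : IsSlInvariant V := fun x _ φ hφ => by
    obtain ⟨h1, h2⟩ := (hV φ).1 hφ
    refine (hV _).2 ⟨rho_mem_sector x h1, ?_⟩
    have hcomm : exchangeOp b J c * rho N x = rho N x * exchangeOp b J c := by
      simp only [exchangeOp, add_mul, mul_add, Finset.sum_mul, Finset.mul_sum, smul_mul_assoc,
        mul_smul_comm, rho_mul_permOp, one_mul, mul_one]
    rw [← Module.End.mul_apply, hcomm, Module.End.mul_apply, h2, map_smul]
  have hVne : V ≠ ⊥ := (Submodule.ne_bot_iff V).2 ⟨ψ₀, (hV ψ₀).2 ⟨hψ₀S, hψ₀E⟩, hψ₀0⟩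
  have hEE : ∀ p, E' p = E := fun p => by
    obtain ⟨φ, hφV, hφ0, hφW⟩ := hmeet p V hVinv inf_le_left hVne
    exact le_antisymm (hΩmin p E φ hφW hφ0 ((hV φ).1 hφV).2)
      (hSmin _ _ (hΩS p) (hΩ0 p) (hΩE p))
  have hΩV : ∀ p, Ω p ∈ V := fun p => (hV _).2 ⟨hΩS p, by rw [hΩE p, hEE p]⟩
  -- every nonzero invariant subspace of `V` contains the relative ground state
  have hΩU : ∀ U : Submodule ℂ (State n N), IsSlInvariant U → U ≤ V → U ≠ ⊥ → Ω 1 ∈ U :=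
    fun U hU hUV hne => by
      obtain ⟨φ, hφU, hφ0, hφW⟩ := hmeet 1 U hU (hUV.trans inf_le_left) hne
      obtain ⟨a, rfl⟩ := hΩuniq 1 φ hφW (by rw [((hV φ).1 (hUV hφU)).2, hEE 1])
      have ha : a ≠ 0 := by
        rintro rfl
        exact hφ0 (zero_smul _ _)
      exact (U.smul_mem_iff ha).1 hφU
  refine ⟨V, ⟨hVne, hVinv, fun U hUV hU => ?_⟩, inf_le_left, fun p => ⟨Ω p, ?_, ?_, hΩV p⟩,
    fun ψ => ⟨?_, ?_⟩⟩
  · by_contra! hcon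
    obtain ⟨hU0, hUne⟩ := hcon
    obtain ⟨U', hU'V, hU'inv, horth, hU'bot⟩ := hU.exists_orthogonal_complement hVinv hUV
    -- the ground state cannot lie both in the subspace and in its complement
    have h1 := hΩU U hU hUV hU0
    have h2 := hΩU U' hU'inv hU'V (mt hU'bot hUne)
    exact hΩ0 1 (coordInner_self_eq_zero _ (horth _ h1 _ h2))
  · exact ⟨hΩW p, hΩ0 p, E' p, hΩE p, hΩmin p⟩
  · rintro Ω' ⟨h1, h2, E'', h3, h4⟩
    have : E'' = E' p :=
      le_antisymm (h4 _ _ (hΩW p) (hΩ0 p) (hΩE p)) (hΩmin p _ _ h1 h2 h3)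
    exact hΩuniq p Ω' h1 (this ▸ h3)
  · rintro ⟨h1, h2, E'', h3, h4⟩
    have : E'' = E := le_antisymm (h4 _ _ hψ₀S hψ₀0 hψ₀E) (hSmin _ _ h1 h2 h3)
    exact ⟨(hV ψ).2 ⟨h1, this ▸ h3⟩, h2⟩
  · rintro ⟨h1, h2⟩
    obtain ⟨h3, h4⟩ := (hV ψ).1 h1
    exact ⟨h3, h2, E, h4, hSmin⟩

end SUChain

end

theorem proposition1 {n N : ℕ} (hn : 1 ≤ n)
    (X : Fin (n ^ 2 - 1) → Matrix (Fin n) (Fin n) ℂ) (hX : SUChain.IsSuBasis X)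
    (b : SUChain.Boundary) (J : Fin (SUChain.bondCount b N) → ℝ) (hJ : ∀ l, 0 < J l)
    (lam : Fin n → ℕ) (hlam : Antitone lam) (hsum : ∑ i, lam i = N)
    (hpar : b = SUChain.Boundary.ring → SUChain.HasDefiniteParity (SUChain.young lam hlam)) :
    ∃ V : Submodule ℂ (SUChain.State n N),
      SUChain.IsMultiplet V ∧
      V ≤ SUChain.sector n N (SUChain.young lam hlam) ∧
      (∀ p : Equiv.Perm (Fin n), ∃ Ω : SUChain.State n N,
        SUChain.IsGroundState (SUChain.hamiltonian b X J)
          (SUChain.weightSpace N (fun i => lam (p i))) Ω ∧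
        (∀ Ω' : SUChain.State n N,
          SUChain.IsGroundState (SUChain.hamiltonian b X J)
            (SUChain.weightSpace N (fun i => lam (p i))) Ω' → ∃ c : ℂ, Ω' = c • Ω) ∧
        Ω ∈ V) ∧
      (∀ ψ : SUChain.State n N,
        SUChain.IsGroundState (SUChain.hamiltonian b X J)
          (SUChain.sector n N (SUChain.young lam hlam)) ψ ↔ ψ ∈ V ∧ ψ ≠ 0) := by
  obtain ⟨c, hc⟩ := SUChain.exists_hamiltonian_eq (N := N) hn hX b J
  rw [hc]
  exact SUChain.exists_ground_multiplet hn hJ c hlam hsum hpar
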